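/- Let $\mathcal H$ and $\mathcal V$ be real Hilbert spaces, with $\mathcal V$ densely and continuously embedded into $\mathcal H$; write $\mathcal V\hookrightarrow\mathcal H=\mathcal H'\hookrightarrow\mathcal V'$ and let $\langle\cdot,\cdot\rangle$ be the duality pairing between $\mathcal V'$ and $\mathcal V$. Let $U=\prod_{j=1}^J U_j$, where each $U_j$ is a closed subspace of $L^2(X_j,\mu_j)^{N_j}$ for a finite measure space $(X_j,\mu_j)$, and let $I_U:\mathcal V\to U$ be linear and continuous. Let $g_j:\mathbb R^{N_j}\to\mathbb R^{N_j}$ be continuous with $(g_j(x)-g_j(y))\cdot(x-y)\ge 0$, $g_j(0)=0$ and $|g_j(x)|\le M(1+|x|)$ for all $x,y$, for some constant $M>0$. Let $\alpha_j:[0,\infty)\times X_j\to(0,\infty)$ satisfy $\alpha_j(t,x)=\alpha(t)$ for all $t\ge 0$, $x\in X_j$ and all $j$, where $\alpha\in C^1([0,\infty);(0,\infty))$ and $\alpha'$ is Lipschitz on $[0,T]$ for every $T>0$. Define $B(t):\mathcal V\to\mathcal V'$ and $B_1:\mathcal V\to\mathcal V'$ by $$\langle B(t)u,v\rangle=\sum_{j=1}^J\int_{X_j}\alpha_j(t,x)\,g_j((I_Uu)_j(x))\cdot(I_Uv)_j(x)\,d\mu_j(x),\qquad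 \langle B_1u,v\rangle=\sum_{j=1}^J\int_{X_j}g_j((I_Uu)_j(x))\cdot(I_Uv)_j(x)\,d\mu_j(x),$$ so that $B(t)=\alpha(t)B_1$. Let $A_1:\mathcal V\to\mathcal V'$ be linear and bounded. For each operator $F:\mathcal V\to\mathcal V'$ considered below, we regard $F$ as an operator in $\mathcal H$ with domain $\{v\in\mathcal V: Fv\in\mathcal H\}$; in particular $\mathcal A_B(t)=A_1+B(t)$ has domain $D(\mathcal A_B(t))=\{v\in\mathcal V:(A_1+B(t))v\in\mathcal H\}$. Assume that, as an operator in $\mathcal H$, $A_1+B_1$ has dense domain and is maximal quasi-monotone, i.e. $A_1+B_1+\omega\,\mathbb I$ is maximal monotone for some $\omega\ge 0$. Assume moreover that there exist $D\in C^1([0,\infty);\mathcal L(\mathcal H))$ and $\tilde D\in C([0,\infty);\mathcal L(\mathcal H))$ such that $D'$ and $\tilde D$ are Lipschitz on $[0,T]$ for every $T>0$; for all $t\ge 0$, $D(t)$ and $\tilde D(t)$ are invertible in $\mathcal L(\mathcal H)$ and $D(t)\tilde D(t)$ is symmetric positive definite; for every $T>0$ there is $c_T>0$ with $$(\tilde D(t)^{-1}D(t)^{-1}x,x)_{\mathcal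 H}\ge c_T\|x\|_{\mathcal H}^2\qquad\forall x\in\mathcal H,\ t\in[0,T];$$ and, as an equality of operators in $\mathcal H$ (including equality of domains), $$(A_1+\alpha(t)B_1)D(t)^{-1}=\tilde D(t)(A_1+B_1)\qquad\forall t\ge 0.$$ Then for every $x_0\in D(\mathcal A_B(0))$ there is a unique function $x\in C([0,\infty);\mathcal H)$ with $x(0)=x_0$ such that $x(t)\in D(\mathcal A_B(t))$ for all $t\ge 0$ and such that, for all $t\ge 0$ outside a countable set, the strong derivative $x'(t)$ exists in $\mathcal H$, $x'(t)=-\mathcal A_B(t)x(t)$, and $s\mapsto\mathcal A_B(s)x(s)$ is continuous at $t$ (at $t=0$ the derivative is one-sided). -/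

import Mathlib

open Set MeasureTheory

noncomputable section

namespace HyperbolicFeedback

section Operators

variable {V H : Type*} [NormedAddCommGroup H] [InnerProductSpace ℝ H]

/-- The part in `H` of the (possibly nonlinear) operator `V → V'` with pairing `F u v = ⟨F u, v⟩`,
given through its graph. Here `ι` embeds `V` into `H`, and `F v ∈ H` with value `h` means that
`⟨F v, w⟩ = (h, w)_H` for all `w` in `V`. The domain of the operator is `{v ∈ V | F v ∈ H}`. -/
def partInH (ι : V → H) (F : V → V → ℝ) : Set (H × H) :=
  {p | ∃ v : V, ι v = p.1 ∧ ∀ w : V, F v w = inner ℝ p.2 (ι w)}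

/-- `partInH ι F` is the graph of a single-valued operator when `ι` is injective with dense
range. -/
theorem partInH_singleValued {ι : V → H} (hι : Function.Injective ι) (hd : DenseRange ι)
    {F : V → V → ℝ} {u h k : H} (hh : (u, h) ∈ partInH ι F) (hk : (u, k) ∈ partInH ι F) :
    h = k := by
  obtain ⟨v, hv, hv2⟩ := hh
  obtain ⟨v', hv', hv2'⟩ := hk
  obtain rfl : v = v' := hι (hv.trans hv'.symm)
  refine hd.eq_of_inner_left ℝ ?_
  intro w
  exact (hv2 w).symm.trans (hv2' w)

/-- The domain of an operator in `H` given by its graph. -/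
def operatorDomain (G : Set (H × H)) : Set H :=
  {u | ∃ z : H, (u, z) ∈ G}

/-- Monotonicity of an operator in `H` given by its graph. -/
def IsMonotoneGraph (G : Set (H × H)) : Prop :=
  ∀ p ∈ G, ∀ q ∈ G, 0 ≤ inner ℝ (p.2 - q.2) (p.1 - q.1)

/-- Maximal monotonicity: a monotone graph without proper monotone extension. -/
def IsMaximalMonotone (G : Set (H × H)) : Prop :=
  IsMonotoneGraph G ∧ ∀ G' : Set (H × H), IsMonotoneGraph G' → G ⊆ G' → G' = G

/-- The operator with graph `G` is maximal quasi-monotone: adding `ω` times the identity makes it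
maximal monotone, for some `ω ≥ 0`. -/
def IsMaximalQuasiMonotone (G : Set (H × H)) : Prop :=
  ∃ ω : ℝ, 0 ≤ ω ∧ IsMaximalMonotone {p : H × H | (p.1, p.2 - ω • p.1) ∈ G}

/-- `x` solves `x'(t) + 𝒜(t) x(t) = 0` for `t ≥ 0`, `x(0) = x₀`, where `G t` is the graph of `𝒜(t)`:
`x` is continuous from `[0, ∞)` to `H`, `x(t)` lies in the domain of `𝒜(t)` for all `t ≥ 0`
(with `z t = 𝒜(t) x(t)`), and, except at countably many `t`, the strong derivative
`x'(t) = -𝒜(t) x(t)` exists and is continuous. -/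
def IsSolution (G : ℝ → Set (H × H)) (x₀ : H) (x : ℝ → H) : Prop :=
  ContinuousOn x (Ici 0) ∧ x 0 = x₀ ∧
    ∃ z : ℝ → H, (∀ t, 0 ≤ t → (x t, z t) ∈ G t) ∧
      ∃ N : Set ℝ, N.Countable ∧ ∀ t, 0 ≤ t → t ∉ N →
        HasDerivWithinAt x (-z t) (Ici 0) t ∧ ContinuousWithinAt z (Ici 0) t

end Operators

/-- Lipschitz continuity on every interval `[0, T]`. -/
def LocallyLipschitzInTime {E : Type*} [NormedAddCommGroup E] (f : ℝ → E) : Prop :=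
  ∀ T : ℝ, 0 < T → ∃ ν : ℝ, 0 < ν ∧
    ∀ s ∈ Icc 0 T, ∀ t ∈ Icc 0 T, ‖f t - f s‖ ≤ ν * |t - s|

section Damping

variable {V : Type*} [NormedAddCommGroup V] [NormedSpace ℝ V]
  {J : ℕ} {X : Fin J → Type*} [∀ j, MeasurableSpace (X j)] {μ : ∀ j, Measure (X j)}
  {N : Fin J → ℕ} {U : ∀ j, Submodule ℝ (Lp (EuclideanSpace ℝ (Fin (N j))) 2 (μ j))}

/-- The pairing
`⟨B u, v⟩ = ∑ j, ∫ a_j(x) g_j((I_U u)_j(x)) · (I_U v)_j(x) dμ_j(x)` with weights `a_j`. -/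
def dampingPairing (IU : V →L[ℝ] (∀ j, U j))
    (g : ∀ j, EuclideanSpace ℝ (Fin (N j)) → EuclideanSpace ℝ (Fin (N j)))
    (a : ∀ j, X j → ℝ) (u v : V) : ℝ :=
  ∑ j, ∫ x, a j x *
    inner ℝ (g j ((IU u j : Lp (EuclideanSpace ℝ (Fin (N j))) 2 (μ j)) x))
      ((IU v j : Lp (EuclideanSpace ℝ (Fin (N j))) 2 (μ j)) x) ∂(μ j)

end Damping

end HyperbolicFeedback

end

open HyperbolicFeedback

/-!
The substitution `y = D x` turns `x' = -𝒜_B(t) x` into `y' = Q(t) y - P(t) z`, `z ∈ 𝒢 y`, where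
`𝒢 = A₁ + B₁ + ω` is maximal monotone and independent of time and `P = D D̃` is symmetric and
positive definite. The operator `P(t) 𝒢` is monotone for the energy `(K(t) u, u)`, `K = P⁻¹`, so
Gronwall's inequality gives uniqueness.

Replacing `𝒢` by its Yosida approximations, the energy of time increments bounds the velocities, and
the approximate solutions converge to some `y` with `z` weakly continuous. The energy inequality for
`y(t + h) - y(t) - h y'(t)` upgrades the weak right derivative of `y` to a strong one at every time.
The kinetic energy `(K y', y')` decreases up to Gronwall-type corrections, hence is continuous off a
countable set; where it is continuous, weak convergence of `y'` becomes strong, so `z` is continuous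
and the right derivative of `y` is two-sided.
-/

namespace HyperbolicFeedback

open Filter Topology

section Minty

variable {E : Type*} [NormedAddCommGroup E] [InnerProductSpace ℝ E]

theorem norm_sub_sq_div_eight_le {C : Set (E × ℝ)} (hconv : Convex ℝ C) {m : ℝ}
    (hm : ∀ p ∈ C, m ≤ p.2 + ‖p.1‖ ^ 2 / 2) {p q : E × ℝ} (hp : p ∈ C) (hq : q ∈ C) :
    ‖p.1 - q.1‖ ^ 2 / 8 ≤ ((p.2 + ‖p.1‖ ^ 2 / 2) + (q.2 + ‖q.1‖ ^ 2 / 2)) / 2 - m := by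
  have hmid := hm _ (hconv hp hq (by norm_num : (0 : ℝ) ≤ 1 / 2)
    (by norm_num : (0 : ℝ) ≤ 1 / 2) (by norm_num))
  simp only [Prod.snd_add, Prod.smul_snd, Prod.fst_add, Prod.smul_fst, smul_eq_mul, ← smul_add,
    norm_smul, Real.norm_eq_abs, abs_of_pos (one_half_pos (α := ℝ))] at hmid
  linarith [parallelogram_law_with_norm ℝ p.1 q.1]

theorem exists_isMinOn_add_half_norm_sq [CompleteSpace E] {C : Set (E × ℝ)} (hc : IsClosed C)
    (hconv : Convex ℝ C) (hne : C.Nonempty)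
    (hbdd : BddBelow ((fun p : E × ℝ => p.2 + ‖p.1‖ ^ 2 / 2) '' C)) :
    ∃ p₀ ∈ C, IsMinOn (fun p : E × ℝ => p.2 + ‖p.1‖ ^ 2 / 2) C p₀ := by
  set φ : E × ℝ → ℝ := fun p => p.2 + ‖p.1‖ ^ 2 / 2
  obtain ⟨v, hanti, hv, hvmem⟩ := exists_seq_tendsto_sInf (hne.image φ) hbdd
  choose p hpC hpv using hvmem
  set m := sInf (φ '' C)
  have hm : ∀ q ∈ C, m ≤ φ q := fun q hq => csInf_le hbdd (mem_image_of_mem φ hq)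
  have hdist : ∀ n k, n ≤ k → dist (p n).1 (p k).1 ≤ √(8 * (v n - m)) := by
    intro n k hnk
    have hsq := norm_sub_sq_div_eight_le hconv hm (hpC n) (hpC k)
    change _ ≤ (φ (p n) + φ (p k)) / 2 - m at hsq
    rw [hpv, hpv] at hsq
    rw [dist_eq_norm]
    exact Real.le_sqrt_of_sq_le (by linarith [hanti hnk])
  have hlim : Tendsto (fun n => √(8 * (v n - m))) atTop (𝓝 0) := by
    simpa using ((hv.sub_const m).const_mul 8).sqrt
  obtain ⟨x, hx⟩ := cauchySeq_tendsto_of_complete (cauchySeq_of_le_tendsto_0' _ hdist hlim)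
  have hsnd : Tendsto (fun n => (p n).2) atTop (𝓝 (m - ‖x‖ ^ 2 / 2)) :=
    (hv.sub ((hx.norm.pow 2).div_const 2)).congr fun n => by simp [← hpv, φ]
  refine ⟨(x, m - ‖x‖ ^ 2 / 2), hc.mem_of_tendsto (hx.prodMk_nhds hsnd) (Eventually.of_forall hpC),
    fun q hq => ?_⟩
  simpa [φ] using hm q hq

theorem sub_add_inner_nonneg_of_isMinOn {C : Set (E × ℝ)} (hconv : Convex ℝ C) {p₀ : E × ℝ}
    (hp₀ : p₀ ∈ C) (hmin : IsMinOn (fun p : E × ℝ => p.2 + ‖p.1‖ ^ 2 / 2) C p₀) {p : E × ℝ}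
    (hp : p ∈ C) : 0 ≤ p.2 - p₀.2 + inner ℝ p₀.1 (p.1 - p₀.1) := by
  have hfst : HasFDerivAt (fun p : E × ℝ => p.1) (ContinuousLinearMap.fst ℝ E ℝ) p₀ :=
    hasFDerivAt_fst
  have hderiv := (hasFDerivAt_snd (𝕜 := ℝ) (p := p₀)).add (hfst.norm_sq.mul_const (2⁻¹ : ℝ))
  have hnonneg := hmin.localize.hasFDerivWithinAt_nonneg
    (by simpa only [div_eq_mul_inv] using! hderiv.hasFDerivWithinAt)
    (sub_mem_posTangentConeAt_of_segment_subset (hconv.segment_subset hp₀ hp))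
  simpa using hnonneg

variable {H : Type*} [NormedAddCommGroup H] [InnerProductSpace ℝ H]

theorem isMaximalMonotone_iff {G : Set (H × H)} : IsMaximalMonotone G ↔ IsMonotoneGraph G ∧
    ∀ x u, (∀ q ∈ G, 0 ≤ inner ℝ (u - q.2) (x - q.1)) → (x, u) ∈ G := by
  refine and_congr_right fun hmono => ⟨fun hmax x u hxu => ?_, fun hmem G' hG' hsub => ?_⟩
  · have hinsert : IsMonotoneGraph (insert (x, u) G) := by
      rintro p (rfl | hp) q (rfl | hq)
      · simp
      · exact hxu q hq
      · rw [← neg_sub u, ← neg_sub x, inner_neg_neg]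
        exact hxu p hp
      · exact hmono p hp q hq
    exact hmax _ hinsert (subset_insert _ _) ▸ mem_insert _ _
  · exact Subset.antisymm (fun p hp => hmem p.1 p.2 fun q hq => hG' p hp q (hsub hq)) hsub

theorem IsMaximalMonotone.mem_of_forall {G : Set (H × H)} (hG : IsMaximalMonotone G) {x u : H}
    (h : ∀ q ∈ G, 0 ≤ inner ℝ (u - q.2) (x - q.1)) : (x, u) ∈ G :=
  (isMaximalMonotone_iff.1 hG).2 x u h

theorem IsMaximalMonotone.nonempty {G : Set (H × H)} (hG : IsMaximalMonotone G) : G.Nonempty := by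
  by_contra hempty
  rw [not_nonempty_iff_eq_empty] at hempty
  have hzero : ((0 : H), (0 : H)) ∈ G := hG.mem_of_forall (by simp [hempty])
  simp [hempty] at hzero

theorem IsMaximalMonotone.smul_sub_const {G : Set (H × H)} (hG : IsMaximalMonotone G) {l : ℝ}
    (hl : 0 < l) (w : H) : IsMaximalMonotone {p : H × H | (p.1, l⁻¹ • (p.2 + w)) ∈ G} := by
  refine isMaximalMonotone_iff.2 ⟨fun p hp q hq => ?_, fun x u h => hG.mem_of_forall fun q hq => ?_⟩
  · have hpq := hG.1 _ hp _ hq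
    simp only [← smul_sub, inner_smul_left, RCLike.conj_to_real, add_sub_add_right_eq_sub] at hpq
    exact nonneg_of_mul_nonneg_right hpq (inv_pos.2 hl)
  · have hxq := h (q.1, l • q.2 - w) (by
      simpa only [mem_ofPred_eq, sub_add_cancel, smul_smul, inv_mul_cancel₀ hl.ne', one_smul]
        using hq)
    have hscale : l⁻¹ • (u + w) - q.2 = l⁻¹ • (u - (l • q.2 - w)) := by
      rw [sub_sub_eq_add_sub, smul_sub, inv_smul_smul₀ hl.ne']
    rw [hscale, inner_smul_left]
    exact mul_nonneg (inv_pos.2 hl).le hxq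

/-- The epigraph of the Fitzpatrick function `sup_{(y, v) ∈ G} ⟪x, v⟫ + ⟪y, u⟫ - ⟪y, v⟫` of an
operator with graph `G`; the pairs `(x, u)` carry the Hilbert norm of `WithLp 2`. -/
def fitzpatrickEpigraph (G : Set (H × H)) : Set (WithLp 2 (H × H) × ℝ) :=
  {p | ∀ q ∈ G, inner ℝ p.1.fst q.2 + inner ℝ q.1 p.1.snd - inner ℝ q.1 q.2 ≤ p.2}

theorem isClosed_fitzpatrickEpigraph (G : Set (H × H)) : IsClosed (fitzpatrickEpigraph G) := by
  have hinter : fitzpatrickEpigraph G = ⋂ q ∈ G, {p : WithLp 2 (H × H) × ℝ |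
      inner ℝ p.1.fst q.2 + inner ℝ q.1 p.1.snd - inner ℝ q.1 q.2 ≤ p.2} := by
    ext p
    simp [fitzpatrickEpigraph]
  rw [hinter]
  exact isClosed_biInter fun q _ => isClosed_le (by fun_prop) continuous_snd

theorem convex_fitzpatrickEpigraph (G : Set (H × H)) : Convex ℝ (fitzpatrickEpigraph G) := by
  intro p hp q hq a b ha hb hab v hv
  have hpv := mul_le_mul_of_nonneg_left (hp v hv) ha
  have hqv := mul_le_mul_of_nonneg_left (hq v hv) hb
  simp only [Prod.fst_add, Prod.smul_fst, Prod.snd_add, Prod.smul_snd, WithLp.add_fst,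
    WithLp.add_snd, WithLp.smul_fst, WithLp.smul_snd, inner_add_left, inner_add_right,
    inner_smul_left, inner_smul_right, smul_eq_mul, RCLike.conj_to_real]
  linear_combination hpv + hqv + inner ℝ v.1 v.2 * hab

theorem IsMonotoneGraph.mk_inner_mem_fitzpatrickEpigraph {G : Set (H × H)}
    (hG : IsMonotoneGraph G) {p : H × H} (hp : p ∈ G) :
    (WithLp.toLp 2 p, inner ℝ p.1 p.2) ∈ fitzpatrickEpigraph G := by
  intro q hq
  have hpq := hG p hp q hq
  simp only [inner_sub_right, real_inner_comm p.1, real_inner_comm q.1] at hpq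
  simp only [WithLp.toLp_fst, WithLp.toLp_snd]
  linarith

theorem IsMaximalMonotone.inner_le_of_mem_fitzpatrickEpigraph {G : Set (H × H)}
    (hG : IsMaximalMonotone G) {p : WithLp 2 (H × H) × ℝ} (hp : p ∈ fitzpatrickEpigraph G) :
    inner ℝ p.1.fst p.1.snd ≤ p.2 := by
  by_contra! hlt
  have hmem : (p.1.fst, p.1.snd) ∈ G := hG.mem_of_forall fun q hq => by
    have hpq := hp q hq
    simp only [inner_sub_right, real_inner_comm p.1.fst, real_inner_comm q.1]
    linarith
  have hself := hp _ hmem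
  simp only [add_sub_cancel_right] at hself
  exact hlt.not_ge hself

theorem IsMaximalMonotone.exists_neg_mem [CompleteSpace H] {G : Set (H × H)}
    (hG : IsMaximalMonotone G) : ∃ x : H, (x, -x) ∈ G := by
  have hbdd : BddBelow ((fun p : WithLp 2 (H × H) × ℝ => p.2 + ‖p.1‖ ^ 2 / 2) ''
      fitzpatrickEpigraph G) := by
    refine ⟨0, forall_mem_image.2 fun p hp => ?_⟩
    rw [WithLp.prod_norm_sq_eq_of_L2]
    linarith [hG.inner_le_of_mem_fitzpatrickEpigraph hp, norm_add_sq_real p.1.fst p.1.snd,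
      sq_nonneg ‖p.1.fst + p.1.snd‖]
  obtain ⟨q, hq⟩ := hG.nonempty
  obtain ⟨⟨p, r⟩, hp, hmin⟩ := exists_isMinOn_add_half_norm_sq (isClosed_fitzpatrickEpigraph G)
    (convex_fitzpatrickEpigraph G) ⟨_, hG.1.mk_inner_mem_fitzpatrickEpigraph hq⟩ hbdd
  -- The negated and swapped minimiser is monotonically related to `G`, with a quadratic surplus.
  have hrelated : ∀ q ∈ G, ‖p.fst + p.snd‖ ^ 2 ≤ inner ℝ (-p.fst - q.2) (-p.snd - q.1) := by
    intro q hq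
    have hopt := sub_add_inner_nonneg_of_isMinOn (convex_fitzpatrickEpigraph G) hp hmin
      (hG.1.mk_inner_mem_fitzpatrickEpigraph hq)
    have hpr : inner ℝ p.fst p.snd ≤ r := hG.inner_le_of_mem_fitzpatrickEpigraph hp
    simp only [inner_sub_right, WithLp.prod_inner_apply, WithLp.ofLp_fst, WithLp.ofLp_snd,
      real_inner_self_eq_norm_sq] at hopt
    simp only [inner_sub_left, inner_sub_right, inner_neg_left, inner_neg_right,
      norm_add_sq_real, real_inner_comm p.snd q.2, real_inner_comm q.1 q.2]
    linarith
  have hmem : (-p.snd, -p.fst) ∈ G :=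
    hG.mem_of_forall fun q hq => (sq_nonneg _).trans (hrelated q hq)
  have hsum := hrelated _ hmem
  simp only [sub_self, inner_zero_left] at hsum
  have hneg : p.fst = -p.snd :=
    eq_neg_of_add_eq_zero_left (norm_eq_zero.1 (pow_eq_zero_iff two_ne_zero |>.1
      (le_antisymm hsum (sq_nonneg _))))
  exact ⟨-p.snd, by rwa [hneg] at hmem⟩

/-- `a` is the Yosida approximation with parameter `l` of the operator `A` with graph `G`: the
inclusion `a x ∈ A (x - l a x)` says that `a x = l⁻¹ (x - (1 + l A)⁻¹ x)`. -/
def IsYosidaApproximation (G : Set (H × H)) (l : ℝ) (a : H → H) : Prop :=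
  ∀ x, (x - l • a x, a x) ∈ G

theorem IsMaximalMonotone.exists_isYosidaApproximation [CompleteSpace H] {G : Set (H × H)}
    (hG : IsMaximalMonotone G) {l : ℝ} (hl : 0 < l) : ∃ a, IsYosidaApproximation G l a := by
  choose r hr using fun w => (hG.smul_sub_const hl w).exists_neg_mem
  refine ⟨fun x => l⁻¹ • (-r x + x), fun x => ?_⟩
  simpa [smul_smul, mul_inv_cancel₀ hl.ne'] using hr x

namespace IsYosidaApproximation

variable {G : Set (H × H)} {l : ℝ} {a : H → H}

theorem mul_norm_sub_sq_le_inner (ha : IsYosidaApproximation G l a) (hG : IsMonotoneGraph G)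
    (x y : H) : l * ‖a x - a y‖ ^ 2 ≤ inner ℝ (a x - a y) (x - y) := by
  have hmono := hG _ (ha x) _ (ha y)
  have hres : x - l • a x - (y - l • a y) = x - y - l • (a x - a y) := by
    rw [smul_sub]
    abel
  simp only [hres, inner_sub_right _ (x - y), inner_smul_right, real_inner_self_eq_norm_sq] at hmono
  linarith

theorem norm_sub_le (ha : IsYosidaApproximation G l a) (hG : IsMonotoneGraph G) (hl : 0 < l)
    (x y : H) : ‖a x - a y‖ ≤ l⁻¹ * ‖x - y‖ := by
  have hle := (ha.mul_norm_sub_sq_le_inner hG x y).trans (real_inner_le_norm _ _)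
  rw [inv_mul_eq_div, le_div_iff₀ hl]
  by_contra! hlt
  have hpos : 0 < ‖a x - a y‖ := by
    by_contra! hnonpos
    nlinarith [norm_nonneg (a x - a y), norm_nonneg (x - y)]
  nlinarith

theorem norm_le_of_mem (ha : IsYosidaApproximation G l a) (hG : IsMonotoneGraph G) (hl : 0 < l)
    {x u : H} (hu : (x, u) ∈ G) : ‖a x‖ ≤ ‖u‖ := by
  have hmono := hG _ (ha x) _ hu
  simp only [sub_sub_cancel_left, inner_neg_right, inner_smul_right, inner_sub_left,
    real_inner_self_eq_norm_sq] at hmono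
  have hle : ‖a x‖ ^ 2 ≤ ‖u‖ * ‖a x‖ :=
    (sub_nonpos.1 (nonpos_of_mul_nonpos_right (neg_nonneg.1 hmono) hl)).trans
      (real_inner_le_norm _ _)
  nlinarith [norm_nonneg (a x), norm_nonneg u]

end IsYosidaApproximation

end Minty

section WeakLimit

variable {H : Type*} [NormedAddCommGroup H] [InnerProductSpace ℝ H]
  {β : Type*} {x z : β → H} {a : H} {C : ℝ}

theorem exists_tendsto_inner_of_ultrafilter [CompleteSpace H] (F : Ultrafilter β)
    (hz : ∀ᶠ n in F, ‖z n‖ ≤ C) :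
    ∃ v : H, ∀ w, Tendsto (fun n => (inner ℝ (z n) w : ℝ)) F (𝓝 (inner ℝ v w)) := by
  let f : β → WeakDual ℝ H := fun n => StrongDual.toWeakDual (InnerProductSpace.toDual ℝ H (z n))
  have hf : WeakDual.toStrongDual ⁻¹' Metric.closedBall 0 C ∈ F.map f := by
    rw [Ultrafilter.mem_map]
    filter_upwards [hz] with n hn
    simpa [f] using hn
  obtain ⟨ℓ, -, hlim⟩ := (WeakDual.isCompact_closedBall 0 C).ultrafilter_le_nhds' _ hf
  obtain ⟨v, hv⟩ := (InnerProductSpace.toDual ℝ H).surjective (WeakDual.toStrongDual ℓ)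
  refine ⟨v, fun w => ?_⟩
  have hvw : ℓ w = inner ℝ v w := congrArg (fun g : StrongDual ℝ H => g w) hv.symm
  rw [← hvw]
  exact ((WeakDual.eval_continuous w).tendsto ℓ).comp hlim

theorem tendsto_inner_of_tendsto_of_tendsto_inner {F : Filter β} {v : H}
    (hx : Tendsto x F (𝓝 a)) (hz : ∀ᶠ n in F, ‖z n‖ ≤ C)
    (hv : ∀ w, Tendsto (fun n => (inner ℝ (z n) w : ℝ)) F (𝓝 (inner ℝ v w))) :
    Tendsto (fun n => (inner ℝ (z n) (x n) : ℝ)) F (𝓝 (inner ℝ v a)) := by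
  have hdiff : Tendsto (fun n => (inner ℝ (z n) (x n - a) : ℝ)) F (𝓝 0) := by
    have hbound : Tendsto (fun n => C * ‖x n - a‖) F (𝓝 0) := by
      simpa using (tendsto_iff_norm_sub_tendsto_zero.1 hx).const_mul C
    refine squeeze_zero_norm' ?_ hbound
    filter_upwards [hz] with n hn
    exact (norm_inner_le_norm _ _).trans (by gcongr)
  simpa [← inner_add_right] using hdiff.add (hv a)

theorem norm_le_of_tendsto_inner {F : Filter β} [F.NeBot] {v : H} (hz : ∀ᶠ n in F, ‖z n‖ ≤ C)
    (hv : ∀ w, Tendsto (fun n => (inner ℝ (z n) w : ℝ)) F (𝓝 (inner ℝ v w))) : ‖v‖ ≤ C := by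
  have hsq : ‖v‖ * ‖v‖ ≤ C * ‖v‖ := by
    rw [← real_inner_self_eq_norm_mul_norm]
    refine le_of_tendsto (hv v) (hz.mono fun n hn => ?_)
    exact (real_inner_le_norm _ _).trans (by gcongr)
  obtain ⟨n, hn⟩ := hz.exists
  by_contra! hlt
  exact (mul_lt_mul_of_pos_right hlt (((norm_nonneg _).trans hn).trans_lt hlt)).not_ge hsq

theorem IsMaximalMonotone.mem_of_tendsto_inner {G : Set (H × H)} (hG : IsMaximalMonotone G)
    {F : Filter β} [F.NeBot] {v : H} (hmem : ∀ᶠ n in F, (x n, z n) ∈ G) (hx : Tendsto x F (𝓝 a))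
    (hz : ∀ᶠ n in F, ‖z n‖ ≤ C)
    (hv : ∀ w, Tendsto (fun n => (inner ℝ (z n) w : ℝ)) F (𝓝 (inner ℝ v w))) : (a, v) ∈ G := by
  refine hG.mem_of_forall fun q hq => ?_
  have hlim : Tendsto (fun n => (inner ℝ (z n - q.2) (x n - q.1) : ℝ)) F
      (𝓝 (inner ℝ (v - q.2) (a - q.1))) := by
    simp only [inner_sub_left _ q.2]
    refine Tendsto.sub ?_ (tendsto_const_nhds.inner (hx.sub_const _))
    exact tendsto_inner_of_tendsto_of_tendsto_inner (hx.sub_const _) hz hv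
  refine ge_of_tendsto hlim ?_
  filter_upwards [hmem] with n hn using hG.1 _ hn _ hq

/-- The graph `G` is that of a single-valued operator. -/
def IsSingleValued {X Y : Type*} (G : Set (X × Y)) : Prop :=
  ∀ ⦃x u v⦄, (x, u) ∈ G → (x, v) ∈ G → u = v

theorem IsMaximalMonotone.exists_mem_forall_tendsto_inner [CompleteSpace H] {G : Set (H × H)}
    (hG : IsMaximalMonotone G) (hsv : IsSingleValued G) {F : Filter β} [F.NeBot]
    (hmem : ∀ᶠ n in F, (x n, z n) ∈ G) (hx : Tendsto x F (𝓝 a)) (hz : ∀ᶠ n in F, ‖z n‖ ≤ C) :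
    ∃ v : H, (a, v) ∈ G ∧
      ∀ w, Tendsto (fun n => (inner ℝ (z n) w : ℝ)) F (𝓝 (inner ℝ v w)) := by
  have hultra : ∀ U : Ultrafilter β, (U : Filter β) ≤ F → ∃ v : H, (a, v) ∈ G ∧
      ∀ w, Tendsto (fun n => (inner ℝ (z n) w : ℝ)) U (𝓝 (inner ℝ v w)) := by
    intro U hU
    obtain ⟨v, hv⟩ := exists_tendsto_inner_of_ultrafilter U (hz.filter_mono hU)
    exact ⟨v, hG.mem_of_tendsto_inner (hmem.filter_mono hU) (hx.mono_left hU)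
      (hz.filter_mono hU) hv, hv⟩
  obtain ⟨v, hv, -⟩ := hultra (Ultrafilter.of F) (Ultrafilter.of_le F)
  refine ⟨v, hv, fun w => (tendsto_iff_ultrafilter _ _ _).2 fun U hU => ?_⟩
  obtain ⟨v', hv', hlim⟩ := hultra U hU
  exact hsv hv hv' ▸ hlim w

end WeakLimit

section Dini

/-- The upper right Dini derivative of `F` at `t` is at most `d`. -/
def UpperRightDiniLE (F : ℝ → ℝ) (d t : ℝ) : Prop :=
  ∀ ε > 0, ∀ᶠ s in 𝓝[>] t, F s - F t ≤ (s - t) * (d + ε)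

namespace UpperRightDiniLE

variable {F G e : ℝ → ℝ} {d d' e' t : ℝ}

theorem of_eventually_le (h : ∀ᶠ s in 𝓝[>] t, F s - F t ≤ (s - t) * G s)
    (hG : Tendsto G (𝓝[>] t) (𝓝 d)) : UpperRightDiniLE F d t := by
  intro ε hε
  filter_upwards [h, hG.eventually (gt_mem_nhds (lt_add_of_pos_right d hε)),
    self_mem_nhdsWithin] with s hs hGs hst
  exact hs.trans (mul_le_mul_of_nonneg_left hGs.le (sub_nonneg.2 (le_of_lt hst)))

theorem of_hasDerivWithinAt (h : HasDerivWithinAt F d (Ioi t) t) : UpperRightDiniLE F d t :=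
  of_eventually_le (Eventually.of_forall fun s => (sub_smul_slope F t s).ge)
    ((hasDerivWithinAt_iff_tendsto_slope' self_notMem_Ioi).1 h)

theorem mono (h : UpperRightDiniLE F d t) (hd : d ≤ d') : UpperRightDiniLE F d' t := by
  intro ε hε
  filter_upwards [h ε hε, self_mem_nhdsWithin] with s hs hst
  exact hs.trans (mul_le_mul_of_nonneg_left (by linarith) (sub_nonneg.2 (le_of_lt hst)))

theorem add (hF : UpperRightDiniLE F d t) (hG : UpperRightDiniLE G d' t) :
    UpperRightDiniLE (fun s => F s + G s) (d + d') t := by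
  intro ε hε
  filter_upwards [hF _ (half_pos hε), hG _ (half_pos hε)] with s hFs hGs
  linarith

theorem mul_of_hasDerivWithinAt (hF : UpperRightDiniLE F d t)
    (he : HasDerivWithinAt e e' (Ioi t) t) (hpos : 0 < e t) :
    UpperRightDiniLE (fun s => e s * F s) (e t * d + e' * F t) t := by
  intro ε hε
  set δ := ε / (3 * e t)
  have hδ : e t * δ = ε / 3 := by simp only [δ]; field_simp
  have hlim : Tendsto (fun s => e s * (d + δ)) (𝓝[>] t) (𝓝 (e t * (d + δ))) :=
    he.continuousWithinAt.tendsto.mul_const _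
  filter_upwards [hF δ (by positivity), of_hasDerivWithinAt (he.mul_const (F t)) (ε / 3)
    (by positivity), hlim.eventually (gt_mem_nhds (lt_add_of_pos_right _ (show 0 < ε / 3 by
    positivity))), he.continuousWithinAt.tendsto.eventually (lt_mem_nhds hpos),
    self_mem_nhdsWithin] with s hFs hes hlims hepos hst
  have hsplit := mul_le_mul_of_nonneg_left hFs hepos.le
  have hweight := mul_le_mul_of_nonneg_left hlims.le (sub_nonneg.2 (le_of_lt hst))
  calc e s * F s - e t * F t = e s * (F s - F t) + (e s * F t - e t * F t) := by ring
    _ ≤ (s - t) * (e t * (d + δ) + ε / 3) + (s - t) * (e' * F t + ε / 3) := by linarith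
    _ = (s - t) * (e t * d + e' * F t + ε) := by rw [mul_add (e t), hδ]; ring

end UpperRightDiniLE

theorem exists_eq_forall_lt_of_continuousOn {G : ℝ → ℝ} {a b y : ℝ} (hab : a ≤ b)
    (hG : ContinuousOn G (Icc a b)) (hay : G a ≤ y) (hyb : y < G b) :
    ∃ t ∈ Ico a b, G t = y ∧ ∀ s ∈ Ioc t b, y < G s := by
  have hcomp : IsCompact (Icc a b ∩ G ⁻¹' Iic y) :=
    isCompact_Icc.of_isClosed_subset (hG.preimage_isClosed_of_isClosed isClosed_Icc isClosed_Iic)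
      inter_subset_left
  obtain ⟨t, ⟨ht, hty⟩, hgreatest⟩ := hcomp.exists_isGreatest ⟨a, left_mem_Icc.2 hab, hay⟩
  have htb : t < b := ht.2.lt_of_ne (by rintro rfl; exact hyb.not_ge hty)
  refine ⟨t, ⟨ht.1, htb⟩, ?_, fun s hs => ?_⟩
  · obtain ⟨s, hs, rfl⟩ := intermediate_value_Icc htb.le (hG.mono (Icc_subset_Icc_left ht.1))
      ⟨hty, hyb.le⟩
    rw [le_antisymm (hgreatest ⟨⟨ht.1.trans hs.1, hs.2⟩, mem_preimage.2 (mem_Iic.2 le_rfl)⟩) hs.1]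
  · by_contra! hle
    exact hs.1.not_ge (hgreatest ⟨⟨ht.1.trans hs.1.le, hs.2⟩, hle⟩)

theorem le_of_upperRightDiniLE_neg {F : ℝ → ℝ} {a b δ : ℝ} (hab : a ≤ b) (hδ : 0 < δ)
    (hF : ContinuousOn F (Icc a b)) {N : Set ℝ} (hN : N.Countable)
    (h : ∀ t ∈ Ico a b, t ∉ N → UpperRightDiniLE F (-δ) t) : F b ≤ F a := by
  by_contra! hlt
  -- The last time at which `F` attains a value `y` lies in `N`, for uncountably many `y`.
  choose! T hT hTy hlast using fun y (hy : y ∈ Ioo (F a) (F b)) =>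
    exists_eq_forall_lt_of_continuousOn hab hF hy.1.le hy.2
  have hmaps : MapsTo T (Ioo (F a) (F b)) N := by
    intro y hy
    by_contra hTN
    obtain ⟨s, hdini, hs⟩ := ((h _ (hT y hy) hTN δ hδ).and (Ioc_mem_nhdsGT (hT y hy).2)).exists
    rw [hTy y hy, neg_add_cancel, mul_zero] at hdini
    linarith [hlast y hy s hs]
  have hinj : InjOn T (Ioo (F a) (F b)) := fun y hy y' hy' heq => by
    rw [← hTy y hy, ← hTy y' hy', heq]
  have hzero := (hmaps.countable_of_injOn hinj hN).measure_zero volume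
  rw [Real.volume_Ioo, ENNReal.ofReal_eq_zero] at hzero
  linarith

theorem le_of_upperRightDiniLE_zero {F : ℝ → ℝ} {a b : ℝ} (hab : a ≤ b)
    (hF : ContinuousOn F (Icc a b)) {N : Set ℝ} (hN : N.Countable)
    (h : ∀ t ∈ Ico a b, t ∉ N → UpperRightDiniLE F 0 t) : F b ≤ F a := by
  have htilt : ∀ δ > 0, F b - δ * b ≤ F a - δ * a := fun δ hδ =>
    le_of_upperRightDiniLE_neg (F := fun t => F t - δ * t) hab hδ (hF.sub (by fun_prop)) hN
      fun t ht htN => by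
        have hlin : HasDerivWithinAt (fun s => -(δ * s)) (-(δ * 1)) (Ioi t) t :=
          ((hasDerivWithinAt_id t _).const_mul δ).neg
        simpa [sub_eq_add_neg] using (h t ht htN).add (.of_hasDerivWithinAt hlin)
  refine ge_of_tendsto (f := fun δ => F a + δ * (b - a)) (x := 𝓝[>] (0 : ℝ)) ?_ ?_
  · have hcont : Continuous fun δ => F a + δ * (b - a) := by fun_prop
    simpa using (hcont.tendsto 0).mono_left nhdsWithin_le_nhds
  · filter_upwards [self_mem_nhdsWithin] with δ hδ
    linarith [htilt δ hδ]

theorem gronwall_of_upperRightDiniLE {F : ℝ → ℝ} {a b C B : ℝ} (hab : a ≤ b) (hC : 0 ≤ C)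
    (hB : 0 ≤ B) (hF : ContinuousOn F (Icc a b)) {N : Set ℝ} (hN : N.Countable)
    (h : ∀ t ∈ Ico a b, t ∉ N → UpperRightDiniLE F (C * F t + B) t) :
    F b ≤ Real.exp (C * (b - a)) * (F a + B * (b - a)) := by
  set e : ℝ → ℝ := fun t => Real.exp (-(C * (t - a)))
  have hderiv : ∀ t, HasDerivAt e (-(C * e t)) t := fun t => by
    have hexp := (((hasDerivAt_id t).sub_const a).const_mul C).neg.exp
    exact hexp.congr_deriv (by simp [e, mul_comm])
  have hweighted : ∀ t ∈ Ico a b, t ∉ N →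
      UpperRightDiniLE (fun s => e s * F s + -(B * (s - a))) 0 t := fun t ht htN => by
    have hlin : HasDerivWithinAt (fun s => -(B * (s - a))) (-(B * 1)) (Ioi t) t :=
      (((hasDerivWithinAt_id t _).sub_const a).const_mul B).neg
    have hle : e t ≤ 1 := Real.exp_le_one_iff.2 (by nlinarith [ht.1])
    refine (((h t ht htN).mul_of_hasDerivWithinAt (hderiv t).hasDerivWithinAt
      (Real.exp_pos _)).add (.of_hasDerivWithinAt hlin)).mono ?_
    nlinarith
  have hdecr := le_of_upperRightDiniLE_zero (F := fun s => e s * F s + -(B * (s - a))) hab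
    (((by fun_prop : Continuous e).continuousOn.mul hF).add (by fun_prop)) hN hweighted
  simp only [e, sub_self, mul_zero, neg_zero, Real.exp_zero, one_mul, add_zero] at hdecr
  rw [← div_le_iff₀' (Real.exp_pos _), div_eq_mul_inv, ← Real.exp_neg, mul_comm]
  linarith

end Dini

section WeakDerivative

variable {H : Type*} [NormedAddCommGroup H] [InnerProductSpace ℝ H]

/-- `u` is Lipschitz at `t` from the right and has the weak right derivative `f` there. The
Lipschitz bound is what makes the quadratic terms of the energy negligible. -/
def HasWeakRightDeriv (u : ℝ → H) (f : H) (t : ℝ) : Prop :=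
  (∃ L, ∀ᶠ s in 𝓝[>] t, ‖u s - u t‖ ≤ L * (s - t)) ∧
    ∀ w, HasDerivWithinAt (fun s => (inner ℝ (u s) w : ℝ)) (inner ℝ f w) (Ioi t) t

namespace HasWeakRightDeriv

variable {u v : ℝ → H} {f g : H} {t h : ℝ}

theorem of_hasDerivWithinAt (hu : HasDerivWithinAt u f (Ioi t) t) : HasWeakRightDeriv u f t := by
  refine ⟨?_, fun w => by simpa using hu.inner ℝ (hasDerivWithinAt_const t (Ioi t) w)⟩
  obtain ⟨L, hL⟩ := hu.isBigO_sub.bound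
  rw [prod_pure, eventually_map] at hL
  refine ⟨L, ?_⟩
  filter_upwards [hL, self_mem_nhdsWithin] with s hs hst
  rwa [Real.norm_eq_abs, abs_of_pos (sub_pos.2 hst)] at hs

theorem sub (hu : HasWeakRightDeriv u f t) (hv : HasWeakRightDeriv v g t) :
    HasWeakRightDeriv (fun s => u s - v s) (f - g) t := by
  obtain ⟨⟨L, hL⟩, hu⟩ := hu
  obtain ⟨⟨L', hL'⟩, hv⟩ := hv
  refine ⟨⟨L + L', ?_⟩, fun w => ?_⟩
  · filter_upwards [hL, hL'] with s hs hs'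
    rw [sub_sub_sub_comm, add_mul]
    exact (norm_sub_le _ _).trans (add_le_add hs hs')
  · simp only [inner_sub_left]
    exact (hu w).sub (hv w)

theorem sub_const (hu : HasWeakRightDeriv u f t) (x : H) :
    HasWeakRightDeriv (fun s => u s - x) f t := by
  simpa using hu.sub (of_hasDerivWithinAt (hasDerivWithinAt_const t (Ioi t) x))

theorem comp_add_const (hu : HasWeakRightDeriv u f (t + h)) :
    HasWeakRightDeriv (fun s => u (s + h)) f t := by
  have hmaps : MapsTo (· + h) (Ioi t) (Ioi (t + h)) := fun s hs => add_lt_add_left hs h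
  obtain ⟨⟨L, hL⟩, hu⟩ := hu
  refine ⟨⟨L, ?_⟩, fun w => ?_⟩
  · have hshift : Tendsto (· + h) (𝓝[>] t) (𝓝[>] (t + h)) :=
      ((continuous_add_const h).tendsto t).inf (tendsto_principal_principal.2 hmaps)
    filter_upwards [hshift.eventually hL] with s hs
    rwa [add_sub_add_right_eq_sub] at hs
  · simpa only [one_smul, Function.comp_def, id] using
      (hu w).scomp t ((hasDerivAt_id t).add_const h).hasDerivWithinAt hmaps

theorem tendsto (hu : HasWeakRightDeriv u f t) : Tendsto u (𝓝[>] t) (𝓝 (u t)) := by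
  obtain ⟨⟨L, hL⟩, -⟩ := hu
  have hlim : Tendsto (fun s => L * (s - t)) (𝓝 t) (𝓝 (L * (t - t))) :=
    Continuous.tendsto (by fun_prop) t
  rw [sub_self, mul_zero] at hlim
  exact tendsto_iff_norm_sub_tendsto_zero.2
    (squeeze_zero' (.of_forall fun _ => norm_nonneg _) hL (hlim.mono_left nhdsWithin_le_nhds))

end HasWeakRightDeriv

theorem inner_map_self_sub_inner_map_self {K K' : H →L[ℝ] H} (hK : (K : H →ₗ[ℝ] H).IsSymmetric)
    (u v : H) : (inner ℝ (K' v) v : ℝ) - inner ℝ (K u) u = inner ℝ ((K' - K) v) v +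
      2 * (inner ℝ v (K u) - inner ℝ u (K u)) + inner ℝ (K (v - u)) (v - u) := by
  have hsym : ∀ x y, (inner ℝ (K x) y : ℝ) = inner ℝ x (K y) := hK
  simp only [sub_apply, map_sub, inner_sub_left, inner_sub_right]
  rw [hsym u v, hsym u u, hsym v u, real_inner_comm (K v) u, hsym v u]
  ring

theorem inner_map_self_le (T : H →L[ℝ] H) (v : H) : (inner ℝ (T v) v : ℝ) ≤ ‖T‖ * ‖v‖ ^ 2 :=
  calc (inner ℝ (T v) v : ℝ) ≤ ‖T v‖ * ‖v‖ := real_inner_le_norm _ _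
    _ ≤ ‖T‖ * ‖v‖ * ‖v‖ := by gcongr; exact T.le_opNorm v
    _ = ‖T‖ * ‖v‖ ^ 2 := by ring

theorem HasWeakRightDeriv.upperRightDiniLE_energy {u : ℝ → H} {f : H} {t l : ℝ}
    {K : ℝ → H →L[ℝ] H} (hu : HasWeakRightDeriv u f t) (hK : ∀ s, ‖K s - K t‖ ≤ l * |s - t|)
    (hsym : (K t : H →ₗ[ℝ] H).IsSymmetric) :
    UpperRightDiniLE (fun s => inner ℝ (K s (u s)) (u s))
      (l * ‖u t‖ ^ 2 + 2 * inner ℝ (K t f) (u t)) t := by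
  have hcont := hu.tendsto
  obtain ⟨⟨L, hL⟩, hweak⟩ := hu
  refine .of_eventually_le (G := fun s => l * ‖u s‖ ^ 2 +
    2 * slope (fun s => (inner ℝ (u s) (K t (u t)) : ℝ)) t s + ‖K t‖ * L ^ 2 * (s - t)) ?_ ?_
  · filter_upwards [hL, self_mem_nhdsWithin] with s hs hst
    have hst : 0 < s - t := sub_pos.2 hst
    have hcoeff : (inner ℝ ((K s - K t) (u s)) (u s) : ℝ) ≤ (s - t) * (l * ‖u s‖ ^ 2) := by
      have hKs := hK s
      rw [abs_of_pos hst] at hKs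
      refine (inner_map_self_le _ _).trans ?_
      calc ‖K s - K t‖ * ‖u s‖ ^ 2 ≤ l * (s - t) * ‖u s‖ ^ 2 := by gcongr
        _ = (s - t) * (l * ‖u s‖ ^ 2) := by ring
    have hquad : (inner ℝ (K t (u s - u t)) (u s - u t) : ℝ) ≤
        (s - t) * (‖K t‖ * L ^ 2 * (s - t)) := by
      refine (inner_map_self_le _ _).trans ?_
      calc ‖K t‖ * ‖u s - u t‖ ^ 2 ≤ ‖K t‖ * (L * (s - t)) ^ 2 := by gcongr
        _ = (s - t) * (‖K t‖ * L ^ 2 * (s - t)) := by ring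
    have hslope := sub_smul_slope (fun s => (inner ℝ (u s) (K t (u t)) : ℝ)) t s
    rw [smul_eq_mul, vsub_eq_sub] at hslope
    rw [inner_map_self_sub_inner_map_self hsym (u t) (u s), ← hslope]
    linarith
  · have hslope := (hasDerivWithinAt_iff_tendsto_slope' self_notMem_Ioi).1 (hweak (K t (u t)))
    have hlin : Tendsto (fun s => ‖K t‖ * L ^ 2 * (s - t)) (𝓝[>] t) (𝓝 0) := by
      have hcont : Continuous fun s => ‖K t‖ * L ^ 2 * (s - t) := by fun_prop
      simpa using (hcont.tendsto t).mono_left nhdsWithin_le_nhds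
    have hself : (inner ℝ (K t f) (u t) : ℝ) = inner ℝ f (K t (u t)) := hsym _ _
    simpa only [hself, add_zero] using
      (((hcont.norm.pow 2).const_mul l).add (hslope.const_mul 2)).add hlin

end WeakDerivative

section GlobalODE

variable {E : Type*} [NormedAddCommGroup E] [NormedSpace ℝ E]

theorem exp_neg_mul_norm_integral_le {g : ℝ → E} {k δ : ℝ} (hk : 0 < k) (hδ : 0 ≤ δ)
    (hg : ∀ s, 0 ≤ s → ‖g s‖ ≤ δ * Real.exp (k * s)) {t : ℝ} (ht : 0 ≤ t) :
    Real.exp (-(k * t)) * ‖∫ s in (0 : ℝ)..t, g s‖ ≤ δ / k := by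
  have hnorm : ‖∫ s in (0 : ℝ)..t, g s‖ ≤ ∫ s in (0 : ℝ)..t, δ * Real.exp (k * s) :=
    intervalIntegral.norm_integral_le_of_norm_le ht (.of_forall fun s hs => hg s hs.1.le)
      (Continuous.intervalIntegrable (by fun_prop) _ _)
  have hprimitive : ∀ s, HasDerivAt (fun s => δ / k * Real.exp (k * s)) (δ * Real.exp (k * s)) s :=
    fun s => (((hasDerivAt_id s).const_mul k).exp.const_mul (δ / k)).congr_deriv
      (by simp only [id]; field_simp)
  rw [intervalIntegral.integral_eq_sub_of_hasDerivAt (fun s _ => hprimitive s)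
    (Continuous.intervalIntegrable (by fun_prop) _ _)] at hnorm
  calc Real.exp (-(k * t)) * ‖∫ s in (0 : ℝ)..t, g s‖
      ≤ Real.exp (-(k * t)) * (δ / k * Real.exp (k * t)) := by
        gcongr
        exact hnorm.trans (sub_le_self _ (by positivity))
    _ = δ / k := by rw [mul_left_comm, ← Real.exp_add, neg_add_cancel, Real.exp_zero, mul_one]

/-- The Picard operator of `y' = f t y`, `y 0 = x₀`, in terms of `u t = exp (-2kt) y t`. The weight
makes it contracting on `[0, ∞)` when `f` is `k`-Lipschitz. -/
noncomputable def weightedPicard (f : ℝ → E → E) (k : ℝ) (x₀ : E) (u : ℝ → E) (t : ℝ) : E :=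
  Real.exp (-(2 * k * t)) • (x₀ + ∫ s in (0 : ℝ)..t, f s (Real.exp (2 * k * s) • u s))

variable {f : ℝ → E → E} {k B δ : ℝ} {x₀ : E} {u v : ℝ → E}

theorem continuous_uncurry_exp_smul (hf : Continuous (Function.uncurry f)) (hu : Continuous u) :
    Continuous fun s => f s (Real.exp (2 * k * s) • u s) :=
  hf.comp (continuous_id.prodMk (by fun_prop))

theorem norm_weightedPicard_sub_le (hk : 0 < k) (hf : Continuous (Function.uncurry f))
    (hlip : ∀ t x y, ‖f t x - f t y‖ ≤ k * ‖x - y‖) (hu : Continuous u) (hv : Continuous v)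
    (huv : ∀ s, ‖u s - v s‖ ≤ δ) {t : ℝ} (ht : 0 ≤ t) :
    ‖weightedPicard f k x₀ u t - weightedPicard f k x₀ v t‖ ≤ δ / 2 := by
  have hδ : 0 ≤ δ := (norm_nonneg _).trans (huv 0)
  have hbound : ∀ s, 0 ≤ s → ‖f s (Real.exp (2 * k * s) • u s) - f s (Real.exp (2 * k * s) • v s)‖ ≤
      k * δ * Real.exp (2 * k * s) := fun s _ => by
    refine (hlip _ _ _).trans ?_
    rw [← smul_sub, norm_smul, Real.norm_eq_abs, Real.abs_exp]
    calc k * (Real.exp (2 * k * s) * ‖u s - v s‖) ≤ k * (Real.exp (2 * k * s) * δ) := by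
          gcongr
          exact huv s
      _ = k * δ * Real.exp (2 * k * s) := by ring
  have hint := exp_neg_mul_norm_integral_le (by positivity) (by positivity) hbound ht
  rw [intervalIntegral.integral_sub
    ((continuous_uncurry_exp_smul hf hu).intervalIntegrable _ _)
    ((continuous_uncurry_exp_smul hf hv).intervalIntegrable _ _)] at hint
  rw [weightedPicard, weightedPicard, ← smul_sub, norm_smul, Real.norm_eq_abs, Real.abs_exp,
    add_sub_add_left_eq_sub]
  exact hint.trans_eq (by field_simp)

theorem norm_weightedPicard_zero_le (hk : 0 < k) (hB : ∀ t, ‖f t 0‖ ≤ B) {t : ℝ} (ht : 0 ≤ t) :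
    ‖weightedPicard f k x₀ 0 t‖ ≤ ‖x₀‖ + B / (2 * k) := by
  have hB0 : 0 ≤ B := (norm_nonneg _).trans (hB 0)
  have hint : Real.exp (-(2 * k * t)) * ‖∫ s in (0 : ℝ)..t, f s 0‖ ≤ B / (2 * k) :=
    exp_neg_mul_norm_integral_le (by positivity) hB0
      (fun s hs => (hB s).trans (le_mul_of_one_le_right hB0 (Real.one_le_exp (by positivity)))) ht
  have hexp : Real.exp (-(2 * k * t)) ≤ 1 := Real.exp_le_one_iff.2 (neg_nonpos.2 (by positivity))
  simp only [weightedPicard, Pi.zero_apply, smul_zero, norm_smul, Real.norm_eq_abs, Real.abs_exp]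
  calc Real.exp (-(2 * k * t)) * ‖x₀ + ∫ s in (0 : ℝ)..t, f s 0‖
      ≤ Real.exp (-(2 * k * t)) * (‖x₀‖ + ‖∫ s in (0 : ℝ)..t, f s 0‖) := by
        gcongr
        exact norm_add_le _ _
    _ ≤ ‖x₀‖ + B / (2 * k) := by
        rw [mul_add]
        exact add_le_add (mul_le_of_le_one_left (norm_nonneg _) hexp) hint

variable [CompleteSpace E]

theorem hasDerivAt_add_integral {g : ℝ → E} (hg : Continuous g) (x₀ : E) (t : ℝ) :
    HasDerivAt (fun t => x₀ + ∫ s in (0 : ℝ)..t, g s) (g t) t :=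
  (hg.integral_hasStrictDerivAt 0 t).hasDerivAt.const_add x₀

theorem continuous_weightedPicard (hf : Continuous (Function.uncurry f)) (hu : Continuous u) :
    Continuous (weightedPicard f k x₀ u) := by
  have hint : Continuous fun t => x₀ + ∫ s in (0 : ℝ)..t, f s (Real.exp (2 * k * s) • u s) :=
    continuous_iff_continuousAt.2 fun t =>
      (hasDerivAt_add_integral (continuous_uncurry_exp_smul hf hu) x₀ t).continuousAt
  exact Continuous.smul (by fun_prop) hint

theorem exists_weightedPicard_eq_self (hk : 0 < k) (hf : Continuous (Function.uncurry f))
    (hlip : ∀ t x y, ‖f t x - f t y‖ ≤ k * ‖x - y‖) (hB : ∀ t, ‖f t 0‖ ≤ B) (x₀ : E) :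
    ∃ u : ℝ → E, Continuous u ∧ ∀ t, 0 ≤ t → weightedPicard f k x₀ u t = u t := by
  have hbound : ∀ (u : BoundedContinuousFunction ℝ E) (t : ℝ),
      ‖weightedPicard f k x₀ u (max t 0)‖ ≤ ‖u‖ / 2 + (‖x₀‖ + B / (2 * k)) := fun u t => by
    have hdiff := norm_weightedPicard_sub_le (x₀ := x₀) hk hf hlip u.continuous
      (continuous_zero (X := ℝ)) (fun s => by simpa using u.norm_coe_le_norm s) (le_max_right t 0)
    exact (norm_le_norm_sub_add _ _).trans
      (add_le_add hdiff (norm_weightedPicard_zero_le hk hB (le_max_right t 0)))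
  let Φ : BoundedContinuousFunction ℝ E → BoundedContinuousFunction ℝ E := fun u =>
    .ofNormedAddCommGroup (fun t => weightedPicard f k x₀ u (max t 0))
      ((continuous_weightedPicard hf u.continuous).comp (by fun_prop)) _ (hbound u)
  have hΦ : ContractingWith (1 / 2) Φ := by
    refine ⟨by norm_num, LipschitzWith.of_dist_le_mul fun u v => ?_⟩
    refine (BoundedContinuousFunction.dist_le (by positivity)).2 fun t => ?_
    rw [dist_eq_norm, dist_eq_norm]
    refine (norm_weightedPicard_sub_le hk hf hlip u.continuous v.continuous
      (u - v).norm_coe_le_norm (le_max_right t 0)).trans_eq ?_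
    push_cast
    ring
  refine ⟨hΦ.fixedPoint, hΦ.fixedPoint.continuous, fun t ht => ?_⟩
  have hfix := congrArg (fun w : BoundedContinuousFunction ℝ E => w t) hΦ.fixedPoint_isFixedPt
  simpa only [Φ, BoundedContinuousFunction.coe_ofNormedAddCommGroup, max_eq_left ht] using hfix

theorem exists_forall_hasDerivAt_of_lipschitz (hk : 0 < k) (hf : Continuous (Function.uncurry f))
    (hlip : ∀ t x y, ‖f t x - f t y‖ ≤ k * ‖x - y‖) (hB : ∀ t, ‖f t 0‖ ≤ B) (x₀ : E) :
    ∃ y : ℝ → E, y 0 = x₀ ∧ Continuous y ∧ ∀ t, 0 ≤ t → HasDerivAt y (f t (y t)) t := by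
  obtain ⟨u, hu, hfix⟩ := exists_weightedPicard_eq_self hk hf hlip hB x₀
  have hderiv := hasDerivAt_add_integral (continuous_uncurry_exp_smul (k := k) hf hu) x₀
  refine ⟨_, by simp, continuous_iff_continuousAt.2 fun t => (hderiv t).continuousAt,
    fun t ht => ?_⟩
  convert hderiv t using 2
  rw [← hfix t ht, weightedPicard, smul_smul, ← Real.exp_add, add_neg_cancel, Real.exp_zero,
    one_smul]

end GlobalODE

section Evolution

variable {H : Type*} [NormedAddCommGroup H] [InnerProductSpace ℝ H]

/-- Uniform bounds for the coefficients of `y' = Q(t) y - P(t) z`: they are bounded and Lipschitz in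
time with constant `M`, and `K(t)`, which measures the energy `(K(t) u, u)`, is a symmetric left
inverse of `P(t)` that is coercive with constant `c`. -/
structure EvolutionCoefficients (P Q K : ℝ → H →L[ℝ] H) (M c : ℝ) : Prop where
  M_nonneg : 0 ≤ M
  c_pos : 0 < c
  P_le : ∀ t, ‖P t‖ ≤ M
  Q_le : ∀ t, ‖Q t‖ ≤ M
  K_le : ∀ t, ‖K t‖ ≤ M
  P_lip : ∀ s t, ‖P s - P t‖ ≤ M * |s - t|
  Q_lip : ∀ s t, ‖Q s - Q t‖ ≤ M * |s - t|
  K_lip : ∀ s t, ‖K s - K t‖ ≤ M * |s - t|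
  symm : ∀ t, (K t : H →ₗ[ℝ] H).IsSymmetric
  coercive : ∀ t x, c * ‖x‖ ^ 2 ≤ inner ℝ (K t x) x
  left_inv : ∀ t x, K t (P t x) = x

/-- The right-hand side `Q(t) y - P(t) z` of the evolution equation. -/
def velocity (P Q : ℝ → H →L[ℝ] H) (t : ℝ) (y z : H) : H := Q t y - P t z

theorem continuous_of_norm_sub_le {E : Type*} [NormedAddCommGroup E] {f : ℝ → E} {M : ℝ}
    (h : ∀ s t, ‖f s - f t‖ ≤ M * |s - t|) : Continuous f :=
  (LipschitzWith.of_dist_le' fun s t => by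
    simpa only [dist_eq_norm, Real.norm_eq_abs] using h s t).continuous

namespace EvolutionCoefficients

variable {P Q K : ℝ → H →L[ℝ] H} {M c : ℝ} (h : EvolutionCoefficients P Q K M c)

include h

theorem continuous_P : Continuous P := continuous_of_norm_sub_le h.P_lip

theorem continuous_Q : Continuous Q := continuous_of_norm_sub_le h.Q_lip

theorem continuous_K : Continuous K := continuous_of_norm_sub_le h.K_lip

theorem continuousWithinAt_velocity {y z : ℝ → H} {s : Set ℝ} {t : ℝ}
    (hy : ContinuousWithinAt y s t) (hz : ContinuousWithinAt z s t) :
    ContinuousWithinAt (fun r => velocity P Q r (y r) (z r)) s t :=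
  (h.continuous_Q.continuousWithinAt.clm_apply hy).sub
    (h.continuous_P.continuousWithinAt.clm_apply hz)

theorem norm_velocity_le (t : ℝ) (y z : H) : ‖velocity P Q t y z‖ ≤ M * (‖y‖ + ‖z‖) := by
  rw [mul_add]
  exact (norm_sub_le _ _).trans (add_le_add ((Q t).le_of_opNorm_le (h.Q_le t) y)
    ((P t).le_of_opNorm_le (h.P_le t) z))

theorem eq_map_sub_velocity (t : ℝ) (y z : H) : z = K t (Q t y - velocity P Q t y z) := by
  rw [velocity, sub_sub_cancel, h.left_inv]

theorem norm_le_velocity (t : ℝ) (y z : H) : ‖z‖ ≤ M * (‖velocity P Q t y z‖ + M * ‖y‖) := by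
  have hM := h.M_nonneg
  calc ‖z‖ = ‖K t (Q t y - velocity P Q t y z)‖ := by rw [← h.eq_map_sub_velocity]
    _ ≤ M * ‖Q t y - velocity P Q t y z‖ := (K t).le_of_opNorm_le (h.K_le t) _
    _ ≤ M * (‖velocity P Q t y z‖ + M * ‖y‖) := by
        gcongr
        rw [add_comm]
        exact (norm_sub_le _ _).trans (by gcongr; exact (Q t).le_of_opNorm_le (h.Q_le t) y)

theorem energy_le (t : ℝ) (x : H) : (inner ℝ (K t x) x : ℝ) ≤ M * ‖x‖ ^ 2 :=
  (inner_map_self_le _ _).trans (by gcongr; exact h.K_le t)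

theorem inner_velocity_sub_le (s t : ℝ) {y₁ z₁ y₂ z₂ : H} {e : ℝ}
    (he : -inner ℝ (z₁ - z₂) (y₁ - y₂) ≤ e) :
    (inner ℝ (K t (velocity P Q s y₁ z₁ - velocity P Q t y₂ z₂)) (y₁ - y₂) : ℝ) ≤
      e + M ^ 2 * ‖y₁ - y₂‖ ^ 2 + M ^ 2 * |s - t| * (‖z₁‖ + ‖y₁‖) * ‖y₁ - y₂‖ := by
  have hM := h.M_nonneg
  have hsplit : K t (velocity P Q s y₁ z₁ - velocity P Q t y₂ z₂) =
      K t ((Q s - Q t) y₁) + K t (Q t (y₁ - y₂)) - K t ((P s - P t) z₁) - (z₁ - z₂) := by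
    rw [← h.left_inv t (z₁ - z₂), ← map_add, ← map_sub, ← map_sub]
    congr 1
    simp only [velocity, sub_apply, map_sub]
    abel
  have hK : ∀ (x : H) (r : ℝ), ‖x‖ ≤ r → |(inner ℝ (K t x) (y₁ - y₂) : ℝ)| ≤ M * r * ‖y₁ - y₂‖ := by
    intro x r hr
    refine (abs_real_inner_le_norm _ _).trans ?_
    gcongr
    exact ((K t).le_of_opNorm_le (h.K_le t) x).trans (by gcongr)
  have hQs := le_of_abs_le (hK _ _ ((Q s - Q t).le_of_opNorm_le (h.Q_lip s t) y₁))
  have hQt := le_of_abs_le (hK _ _ ((Q t).le_of_opNorm_le (h.Q_le t) (y₁ - y₂)))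
  have hPs := neg_le_of_abs_le (hK _ _ ((P s - P t).le_of_opNorm_le (h.P_lip s t) z₁))
  rw [hsplit, inner_sub_left, inner_sub_left, inner_add_left]
  linarith

theorem energy_gronwall {u : ℝ → H} {a b C B : ℝ} (hab : a ≤ b) (hC : 0 ≤ C) (hB : 0 ≤ B)
    (hu : ContinuousOn u (Icc a b)) {N : Set ℝ} (hN : N.Countable)
    (hd : ∀ t ∈ Ico a b, t ∉ N → ∃ f, HasWeakRightDeriv u f t ∧
      2 * inner ℝ (K t f) (u t) ≤ C * ‖u t‖ ^ 2 + B) :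
    (inner ℝ (K b (u b)) (u b) : ℝ) ≤
      Real.exp ((M + C) / c * (b - a)) * (inner ℝ (K a (u a)) (u a) + B * (b - a)) := by
  have hM := h.M_nonneg
  have hc := h.c_pos
  refine gronwall_of_upperRightDiniLE (F := fun t => inner ℝ (K t (u t)) (u t)) hab
    (by positivity) hB ((h.continuous_K.continuousOn.clm_apply hu).inner hu) hN ?_
  intro t ht htN
  obtain ⟨f, hf, hle⟩ := hd t ht htN
  refine (hf.upperRightDiniLE_energy (fun s => h.K_lip s t) (h.symm t)).mono ?_
  have hcoer : (M + C) * ‖u t‖ ^ 2 ≤ (M + C) / c * inner ℝ (K t (u t)) (u t) := by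
    rw [div_mul_eq_mul_div, le_div_iff₀ hc, mul_assoc]
    gcongr
    linarith [h.coercive t (u t)]
  linarith

theorem norm_sub_sq_le_of_hasDerivWithinAt {y₁ z₁ y₂ z₂ : ℝ → H} {T e : ℝ} (hT : 0 ≤ T)
    (he : 0 ≤ e) (hy₁ : ContinuousOn y₁ (Icc 0 T)) (hy₂ : ContinuousOn y₂ (Icc 0 T))
    {N : Set ℝ} (hN : N.Countable)
    (hd₁ : ∀ t ∈ Ico 0 T, t ∉ N → HasDerivWithinAt y₁ (velocity P Q t (y₁ t) (z₁ t)) (Ioi t) t)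
    (hd₂ : ∀ t ∈ Ico 0 T, t ∉ N → HasDerivWithinAt y₂ (velocity P Q t (y₂ t) (z₂ t)) (Ioi t) t)
    (hmono : ∀ t ∈ Ico 0 T, -inner ℝ (z₁ t - z₂ t) (y₁ t - y₂ t) ≤ e) :
    c * ‖y₁ T - y₂ T‖ ^ 2 ≤
      Real.exp ((M + 2 * M ^ 2) / c * T) * (M * ‖y₁ 0 - y₂ 0‖ ^ 2 + 2 * e * T) := by
  have hgronwall := h.energy_gronwall (u := fun t => y₁ t - y₂ t) (C := 2 * M ^ 2) (B := 2 * e) hT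
    (by positivity) (by positivity) (hy₁.sub hy₂) hN fun t ht htN =>
      ⟨_, .of_hasDerivWithinAt ((hd₁ t ht htN).sub (hd₂ t ht htN)), by
        have hvel := h.inner_velocity_sub_le t t (hmono t ht)
        rw [sub_self, abs_zero, mul_zero, zero_mul, zero_mul, add_zero] at hvel
        linarith⟩
  rw [sub_zero] at hgronwall
  refine (h.coercive T _).trans (hgronwall.trans ?_)
  gcongr
  exact h.energy_le 0 _

end EvolutionCoefficients

end Evolution

theorem tendsto_add_const_nhdsGT_zero (t : ℝ) : Tendsto (fun r => t + r) (𝓝[>] 0) (𝓝[>] t) := by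
  refine tendsto_nhdsWithin_iff.2 ⟨?_, ?_⟩
  · simpa using ((continuous_const_add t).tendsto 0).mono_left nhdsWithin_le_nhds
  · filter_upwards [self_mem_nhdsWithin] with r hr using lt_add_of_pos_right t hr

theorem tendsto_inv_smul_sub_of_hasDerivWithinAt {E : Type*} [NormedAddCommGroup E]
    [NormedSpace ℝ E] {y : ℝ → E} {f : E} {t : ℝ} (hy : HasDerivWithinAt y f (Ioi t) t) :
    Tendsto (fun r => r⁻¹ • (y (t + r) - y t)) (𝓝[>] 0) (𝓝 f) := by
  have hslope := ((hasDerivWithinAt_iff_tendsto_slope' self_notMem_Ioi).1 hy).comp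
    (tendsto_add_const_nhdsGT_zero t)
  simpa only [Function.comp_def, slope_def_module, add_sub_cancel_left] using hslope

section MonotoneTrajectory

variable {H : Type*} [NormedAddCommGroup H] [InnerProductSpace ℝ H]

/-- `(y, z)` solves `y' = Q(t) y - P(t) z` on `[0, ∞)` in the sense of right derivatives, and the
values `(y t, z t)` lie in a common monotone graph. -/
structure IsMonotoneTrajectory (P Q : ℝ → H →L[ℝ] H) (y z : ℝ → H) : Prop where
  continuousOn : ContinuousOn y (Ici 0)
  hasDerivWithinAt : ∀ t, 0 ≤ t → HasDerivWithinAt y (velocity P Q t (y t) (z t)) (Ioi t) t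
  mono : ∀ s t, 0 ≤ s → 0 ≤ t → 0 ≤ (inner ℝ (z s - z t) (y s - y t) : ℝ)

/-- The energy of the velocity of a trajectory. -/
def kineticEnergy (P Q K : ℝ → H →L[ℝ] H) (y z : ℝ → H) (t : ℝ) : ℝ :=
  inner ℝ (K t (velocity P Q t (y t) (z t))) (velocity P Q t (y t) (z t))

/-- The exponential rate at which the energy of the increments of a trajectory can grow. -/
noncomputable def growthRate (M c : ℝ) : ℝ := (M + (2 * M ^ 2 + 1)) / c

namespace EvolutionCoefficients

variable {P Q K : ℝ → H →L[ℝ] H} {M c : ℝ} {y z : ℝ → H}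
  (h : EvolutionCoefficients P Q K M c)

include h

theorem growthRate_nonneg : 0 ≤ growthRate M c := by
  have hM := h.M_nonneg
  have hc := h.c_pos
  unfold growthRate
  positivity

theorem norm_sub_init_sq_le (hyz : IsMonotoneTrajectory P Q y z) {t : ℝ} (ht : 0 ≤ t) :
    c * ‖y t - y 0‖ ^ 2 ≤
      Real.exp (growthRate M c * t) * ((M ^ 2 * (‖y 0‖ + ‖z 0‖)) ^ 2 * t) := by
  have hM := h.M_nonneg
  set D := M ^ 2 * (‖y 0‖ + ‖z 0‖) with hD
  have hgronwall := h.energy_gronwall (u := fun s => y s - y 0) (C := 2 * M ^ 2 + 1)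
    (B := D ^ 2) ht (by positivity) (by positivity)
    ((hyz.continuousOn.mono Icc_subset_Ici_self).sub continuousOn_const) countable_empty
    fun s hs _ => ⟨_, (HasWeakRightDeriv.of_hasDerivWithinAt
      (hyz.hasDerivWithinAt s hs.1)).sub_const (y 0), by
        have hdiff := h.inner_velocity_sub_le s s (neg_nonpos.2 (hyz.mono s 0 hs.1 le_rfl))
        have hinit : (inner ℝ (K s (velocity P Q s (y 0) (z 0))) (y s - y 0) : ℝ) ≤
            D * ‖y s - y 0‖ := by
          refine (real_inner_le_norm _ _).trans ?_
          gcongr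
          refine ((K s).le_of_opNorm_le (h.K_le s) _).trans ?_
          rw [hD, sq, mul_assoc]
          gcongr
          exact h.norm_velocity_le _ _ _
        rw [map_sub, inner_sub_left, sub_self, abs_zero, mul_zero, zero_mul, zero_mul, add_zero,
          zero_add] at hdiff
        linarith [two_mul_le_add_sq D ‖y s - y 0‖]⟩
  simp only [sub_self, map_zero, inner_zero_left, zero_add, sub_zero] at hgronwall
  exact (h.coercive t _).trans hgronwall

theorem energy_increment_le (hyz : IsMonotoneTrajectory P Q y z) {s t r D : ℝ} (hs : 0 ≤ s)
    (hst : s ≤ t) (hr : 0 < r) (hD : ∀ q ∈ Ico s t, M ^ 2 * (‖z (q + r)‖ + ‖y (q + r)‖) ≤ D) :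
    (inner ℝ (K t (y (t + r) - y t)) (y (t + r) - y t) : ℝ) ≤ Real.exp (growthRate M c * (t - s)) *
      (inner ℝ (K s (y (s + r) - y s)) (y (s + r) - y s) + (D * r) ^ 2 * (t - s)) := by
  have hy : ContinuousOn y (Icc s t) := hyz.continuousOn.mono fun q hq => hs.trans hq.1
  have hyr : ContinuousOn (fun q => y (q + r)) (Icc s t) :=
    hyz.continuousOn.comp (by fun_prop) fun q hq => by
      have := hs.trans hq.1
      exact (by positivity : 0 ≤ q + r)
  refine h.energy_gronwall (u := fun q => y (q + r) - y q) (C := 2 * M ^ 2 + 1) (B := (D * r) ^ 2)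
    hst (by positivity) (by positivity) (hyr.sub hy) countable_empty fun q hq _ => ?_
  have hq0 : 0 ≤ q := hs.trans hq.1
  have hqr : 0 ≤ q + r := by positivity
  refine ⟨_, (HasWeakRightDeriv.of_hasDerivWithinAt
    (hyz.hasDerivWithinAt _ hqr)).comp_add_const.sub
      (.of_hasDerivWithinAt (hyz.hasDerivWithinAt q hq0)), ?_⟩
  have hvel := h.inner_velocity_sub_le (q + r) q (neg_nonpos.2 (hyz.mono _ _ hqr hq0))
  rw [add_sub_cancel_left, abs_of_pos hr, zero_add] at hvel
  have htime : M ^ 2 * r * (‖z (q + r)‖ + ‖y (q + r)‖) * ‖y (q + r) - y q‖ ≤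
      D * r * ‖y (q + r) - y q‖ := by
    rw [mul_right_comm (M ^ 2)]
    gcongr
    exact hD q hq
  linarith [two_mul_le_add_sq (D * r) ‖y (q + r) - y q‖]

theorem kineticEnergy_le (hyz : IsMonotoneTrajectory P Q y z) {s t D : ℝ} (hs : 0 ≤ s)
    (hst : s ≤ t)
    (hD : ∀ᶠ r in 𝓝[>] 0, ∀ q ∈ Ico s t, M ^ 2 * (‖z (q + r)‖ + ‖y (q + r)‖) ≤ D) :
    kineticEnergy P Q K y z t ≤
      Real.exp (growthRate M c * (t - s)) * (kineticEnergy P Q K y z s + D ^ 2 * (t - s)) := by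
  have hquot : ∀ q, 0 ≤ q → Tendsto (fun r => (inner ℝ (K q (r⁻¹ • (y (q + r) - y q)))
      (r⁻¹ • (y (q + r) - y q)) : ℝ)) (𝓝[>] 0) (𝓝 (kineticEnergy P Q K y z q)) := fun q hq => by
    have hlim := tendsto_inv_smul_sub_of_hasDerivWithinAt (hyz.hasDerivWithinAt q hq)
    exact (((K q).continuous.tendsto _).comp hlim).inner hlim
  refine le_of_tendsto_of_tendsto (hquot t (hs.trans hst))
    (((hquot s hs).add_const _).const_mul _) ?_
  filter_upwards [hD, self_mem_nhdsWithin] with r hDr hr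
  have hincr := h.energy_increment_le hyz hs hst hr hDr
  simp only [map_smul, inner_smul_left, inner_smul_right, RCLike.conj_to_real]
  have hr : 0 < r := hr
  calc r⁻¹ * (r⁻¹ * inner ℝ (K t (y (t + r) - y t)) (y (t + r) - y t))
      ≤ r⁻¹ * (r⁻¹ * (Real.exp (growthRate M c * (t - s)) *
        (inner ℝ (K s (y (s + r) - y s)) (y (s + r) - y s) + (D * r) ^ 2 * (t - s)))) := by gcongr
    _ = _ := by field_simp

theorem upperRightDiniLE_kineticEnergy (hyz : IsMonotoneTrajectory P Q y z) {t : ℝ} (ht : 0 ≤ t)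
    (hz : ContinuousWithinAt z (Ici t) t) :
    UpperRightDiniLE (kineticEnergy P Q K y z) (growthRate M c * kineticEnergy P Q K y z t +
      (M ^ 2 * (‖z t‖ + ‖y t‖) + 1) ^ 2) t := by
  set D := M ^ 2 * (‖z t‖ + ‖y t‖) + 1
  set C := growthRate M c
  set E := kineticEnergy P Q K y z
  have hy : ContinuousWithinAt y (Ici t) t :=
    (hyz.continuousOn t ht).mono fun q hq => ht.trans hq
  have hD : ∀ᶠ q in 𝓝[≥] t, M ^ 2 * (‖z q‖ + ‖y q‖) ≤ D :=
    ((hz.norm.add hy.norm).const_mul (M ^ 2)).eventually_le_const (lt_add_one _)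
  obtain ⟨a, hta, ha⟩ := (mem_nhdsGE_iff_exists_Ico_subset).1 hD
  have hbound : ∀ s ∈ Ioo t a, E s ≤ Real.exp (C * (s - t)) * (E t + D ^ 2 * (s - t)) :=
    fun s hs => h.kineticEnergy_le hyz ht hs.1.le <| by
      filter_upwards [Ioo_mem_nhdsGT (sub_pos.2 hs.2)] with r hr q hq
      exact ha ⟨by linarith [hq.1, hr.1], by linarith [hq.2, hr.2]⟩
  have hderiv : HasDerivAt (fun s => Real.exp (C * (s - t)) * (E t + D ^ 2 * (s - t)))
      (C * E t + D ^ 2) t := by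
    have hsub : HasDerivAt (fun s => s - t) 1 t := (hasDerivAt_id t).sub_const t
    simpa using (hsub.const_mul C).exp.fun_mul ((hsub.const_mul (D ^ 2)).const_add (E t))
  intro ε hε
  filter_upwards [Ioo_mem_nhdsGT hta, UpperRightDiniLE.of_hasDerivWithinAt
    hderiv.hasDerivWithinAt ε hε] with s hs hle
  simp only [sub_self, mul_zero, Real.exp_zero, one_mul, add_zero] at hle
  linarith [hbound s hs]

theorem norm_velocity_sq_le_of_continuousOn (hyz : IsMonotoneTrajectory P Q y z)
    (hz : ContinuousOn z (Ici 0)) {t Y : ℝ} (ht : 0 ≤ t) (hY : ∀ s ∈ Icc 0 t, ‖y s‖ ≤ Y) :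
    c * ‖velocity P Q t (y t) (z t)‖ ^ 2 ≤ Real.exp ((growthRate M c + 2 * M ^ 6 / c) * t) *
      (M * ‖velocity P Q 0 (y 0) (z 0)‖ ^ 2 + 2 * (M ^ 4 * Y + M ^ 2 * Y + 1) ^ 2 * t) := by
  have hM := h.M_nonneg
  have hc := h.c_pos
  have hC := h.growthRate_nonneg
  have hcont : ContinuousOn (kineticEnergy P Q K y z) (Icc 0 t) := fun s hs => by
    have hvel := h.continuousWithinAt_velocity (hyz.continuousOn s hs.1) (hz s hs.1)
    exact ((h.continuous_K.continuousWithinAt.clm_apply hvel).inner hvel).mono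
      Icc_subset_Ici_self
  have hgronwall := gronwall_of_upperRightDiniLE (C := growthRate M c + 2 * M ^ 6 / c)
    (B := 2 * (M ^ 4 * Y + M ^ 2 * Y + 1) ^ 2) ht (by positivity) (by positivity) hcont
    countable_empty fun s hs _ => by
      refine (h.upperRightDiniLE_kineticEnergy hyz hs.1
        ((hz s hs.1).mono (Ici_subset_Ici.2 hs.1))).mono ?_
      set f := velocity P Q s (y s) (z s)
      have hYs := hY s ⟨hs.1, hs.2.le⟩
      have hforcing : M ^ 2 * (‖z s‖ + ‖y s‖) + 1 ≤
          M ^ 3 * ‖f‖ + (M ^ 4 * Y + M ^ 2 * Y + 1) := by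
        calc M ^ 2 * (‖z s‖ + ‖y s‖) + 1 ≤ M ^ 2 * (M * (‖f‖ + M * Y) + Y) + 1 := by
              gcongr
              exact (h.norm_le_velocity s (y s) (z s)).trans (by gcongr)
          _ = _ := by ring
      have hsq := (pow_le_pow_left₀ (by positivity) hforcing 2).trans add_sq_le
      have hcoer : 2 * M ^ 6 * ‖f‖ ^ 2 ≤ 2 * M ^ 6 / c * kineticEnergy P Q K y z s := by
        rw [div_mul_eq_mul_div, le_div_iff₀ hc, mul_assoc]
        gcongr
        rw [mul_comm]
        exact h.coercive s f
      linarith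
  rw [sub_zero] at hgronwall
  refine (h.coercive t _).trans (hgronwall.trans ?_)
  gcongr
  exact h.energy_le 0 _

theorem exists_norm_le {R : ℝ} (hR : 0 ≤ R) (S : ℝ) :
    ∃ Z, 0 ≤ Z ∧ ∀ y z, IsMonotoneTrajectory P Q y z → ContinuousOn z (Ici 0) →
      ‖y 0‖ ≤ R → ‖z 0‖ ≤ R → ∀ t ∈ Icc 0 S, ‖y t‖ ≤ Z ∧ ‖z t‖ ≤ Z := by
  have hM := h.M_nonneg
  have hc := h.c_pos
  have hC := h.growthRate_nonneg
  set Y := R + √(Real.exp (growthRate M c * S) * ((M ^ 2 * (R + R)) ^ 2 * S) / c)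
  set V := √(Real.exp ((growthRate M c + 2 * M ^ 6 / c) * S) *
    (M * (M * (R + R)) ^ 2 + 2 * (M ^ 4 * Y + M ^ 2 * Y + 1) ^ 2 * S) / c)
  have hY0 : 0 ≤ Y := by positivity
  refine ⟨max Y (M * (V + M * Y)), hY0.trans (le_max_left _ _), ?_⟩
  intro y z hyz hz hy₀ hz₀
  have hy : ∀ t ∈ Icc 0 S, ‖y t‖ ≤ Y := fun t ht => by
    have ht0 := ht.1
    have hdist : ‖y t - y 0‖ ^ 2 ≤
        Real.exp (growthRate M c * S) * ((M ^ 2 * (R + R)) ^ 2 * S) / c := by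
      rw [le_div_iff₀' hc]
      refine (h.norm_sub_init_sq_le hyz ht0).trans ?_
      gcongr <;> exact ht.2
    calc ‖y t‖ ≤ ‖y 0‖ + ‖y t - y 0‖ := norm_le_norm_add_norm_sub' _ _
      _ ≤ Y := add_le_add hy₀ (Real.le_sqrt_of_sq_le hdist)
  intro t ht
  have ht0 := ht.1
  have hvel : ‖velocity P Q t (y t) (z t)‖ ≤ V := by
    refine Real.le_sqrt_of_sq_le ((le_div_iff₀' hc).2 ?_)
    refine (h.norm_velocity_sq_le_of_continuousOn hyz hz ht0
      fun s hs => hy s ⟨hs.1, hs.2.trans ht.2⟩).trans ?_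
    have hvel₀ : ‖velocity P Q 0 (y 0) (z 0)‖ ≤ M * (R + R) :=
      (h.norm_velocity_le _ _ _).trans (by gcongr)
    gcongr <;> exact ht.2
  refine ⟨(hy t ht).trans (le_max_left _ _), ?_⟩
  refine ((h.norm_le_velocity t (y t) (z t)).trans ?_).trans (le_max_right _ _)
  have := hy t ht
  gcongr

end EvolutionCoefficients

end MonotoneTrajectory

section WeakSolution

variable {H : Type*} [NormedAddCommGroup H] [InnerProductSpace ℝ H]

/-- A trajectory starting at `y₀` along which `z` is the Yosida approximation with parameter `l` of
the operator with graph `G`; the element `v₀` of that operator at `y₀` bounds the initial value. -/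
structure IsYosidaTrajectory (G : Set (H × H)) (P Q : ℝ → H →L[ℝ] H) (y₀ v₀ : H) (l : ℝ)
    (y z : ℝ → H) : Prop extends IsMonotoneTrajectory P Q y z where
  init : y 0 = y₀
  norm_init_le : ‖z 0‖ ≤ ‖v₀‖
  continuousOn_z : ContinuousOn z (Ici 0)
  mem : ∀ t, 0 ≤ t → (y t - l • z t, z t) ∈ G

/-- `(y, z)` solves `y' = Q(t) y - P(t) z`, `z ∈ A y`, in the weak sense, where `A` is the operator
with graph `G`. -/
structure IsWeakSolution (G : Set (H × H)) (P Q : ℝ → H →L[ℝ] H) (y z : ℝ → H) : Prop where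
  mem : ∀ t, 0 ≤ t → (y t, z t) ∈ G
  exists_norm_le : ∀ S, ∃ Z, 0 ≤ Z ∧ ∀ t ∈ Icc 0 S, ‖y t‖ ≤ Z ∧ ‖z t‖ ≤ Z
  inner_sub_eq_integral : ∀ s t, 0 ≤ s → s ≤ t → ∀ w, (inner ℝ (y t - y s) w : ℝ) =
    ∫ r in s..t, inner ℝ (velocity P Q r (y r) (z r)) w

theorem tendsto_clm_apply {E β : Type*} [NormedAddCommGroup E] [NormedSpace ℝ E] {F : Filter β}
    {T : β → E →L[ℝ] E} {T₀ : E →L[ℝ] E} {x : β → E} {a : E} (hT : Tendsto T F (𝓝 T₀))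
    (hx : Tendsto x F (𝓝 a)) :
    Tendsto (fun n => T n (x n)) F (𝓝 (T₀ a)) :=
  ((isBoundedBilinearMap_apply (𝕜 := ℝ)).continuous.tendsto (T₀, a)).comp (hT.prodMk_nhds hx)

theorem neg_inner_sub_le_of_sub_smul_mem {G : Set (H × H)} (hG : IsMonotoneGraph G)
    {y₁ z₁ y₂ z₂ : H} {l₁ l₂ Z : ℝ} (hl₁ : 0 ≤ l₁) (hl₂ : 0 ≤ l₂) (h₁ : (y₁ - l₁ • z₁, z₁) ∈ G)
    (h₂ : (y₂ - l₂ • z₂, z₂) ∈ G) (hz₁ : ‖z₁‖ ≤ Z) (hz₂ : ‖z₂‖ ≤ Z) :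
    -(inner ℝ (z₁ - z₂) (y₁ - y₂) : ℝ) ≤ 2 * Z ^ 2 * (l₁ + l₂) := by
  have hZ : 0 ≤ Z := (norm_nonneg _).trans hz₁
  have hmono := hG _ h₁ _ h₂
  simp only [sub_sub_sub_comm y₁, inner_sub_right _ (y₁ - y₂)] at hmono
  calc -(inner ℝ (z₁ - z₂) (y₁ - y₂) : ℝ) ≤ -inner ℝ (z₁ - z₂) (l₁ • z₁ - l₂ • z₂) := by linarith
    _ ≤ ‖z₁ - z₂‖ * ‖l₁ • z₁ - l₂ • z₂‖ := (neg_le_abs _).trans (abs_real_inner_le_norm _ _)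
    _ ≤ (Z + Z) * (l₁ * Z + l₂ * Z) := by
        gcongr
        · exact (norm_sub_le _ _).trans (add_le_add hz₁ hz₂)
        · refine (norm_sub_le _ _).trans ?_
          rw [norm_smul, norm_smul, Real.norm_of_nonneg hl₁, Real.norm_of_nonneg hl₂]
          gcongr
    _ = 2 * Z ^ 2 * (l₁ + l₂) := by ring

namespace EvolutionCoefficients

variable {P Q K : ℝ → H →L[ℝ] H} {M c : ℝ} {G : Set (H × H)} {y₀ v₀ : H}
  (h : EvolutionCoefficients P Q K M c)

include h

theorem exists_isYosidaTrajectory [CompleteSpace H] (hG : IsMaximalMonotone G)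
    (hy₀ : (y₀, v₀) ∈ G) {l : ℝ} (hl : 0 < l) : ∃ y z, IsYosidaTrajectory G P Q y₀ v₀ l y z := by
  have hM := h.M_nonneg
  obtain ⟨a, ha⟩ := hG.exists_isYosidaApproximation hl
  have ha_cont : Continuous a := (LipschitzWith.of_dist_le' fun x y => by
    simpa only [dist_eq_norm] using ha.norm_sub_le hG.1 hl x y).continuous
  obtain ⟨y, hy_init, hy_cont, hy⟩ := exists_forall_hasDerivAt_of_lipschitz
    (f := fun t x => velocity P Q t x (a x)) (k := M * (1 + l⁻¹) + 1) (B := M * ‖a 0‖)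
    (by positivity)
    (((h.continuous_Q.comp continuous_fst).clm_apply continuous_snd).sub
      ((h.continuous_P.comp continuous_fst).clm_apply (ha_cont.comp continuous_snd)))
    (fun t x y => by
      have hsub : velocity P Q t x (a x) - velocity P Q t y (a y) =
          velocity P Q t (x - y) (a x - a y) := by
        simp only [velocity, map_sub]
        abel
      rw [hsub]
      calc ‖velocity P Q t (x - y) (a x - a y)‖ ≤ M * (‖x - y‖ + l⁻¹ * ‖x - y‖) := by
            refine (h.norm_velocity_le _ _ _).trans ?_
            gcongr
            exact ha.norm_sub_le hG.1 hl x y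
        _ = M * (1 + l⁻¹) * ‖x - y‖ := by ring
        _ ≤ (M * (1 + l⁻¹) + 1) * ‖x - y‖ := by gcongr; exact le_add_of_nonneg_right one_pos.le)
    (fun t => by simpa using h.norm_velocity_le t 0 (a 0)) y₀
  refine ⟨y, fun t => a (y t), ⟨hy_cont.continuousOn, fun t ht => (hy t ht).hasDerivWithinAt,
    fun s t _ _ => ?_⟩, hy_init, ?_, (ha_cont.comp hy_cont).continuousOn, fun t _ => ha (y t)⟩
  · exact (by positivity : 0 ≤ l * ‖a (y s) - a (y t)‖ ^ 2).trans
      (ha.mul_norm_sub_sq_le_inner hG.1 _ _)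
  · simpa only [hy_init] using ha.norm_le_of_mem hG.1 hl hy₀

theorem norm_sub_sq_le_of_isYosidaTrajectory (hG : IsMonotoneGraph G) {Z t l₁ l₂ : ℝ}
    (hl₁ : 0 ≤ l₁) (hl₂ : 0 ≤ l₂) {y₁ z₁ y₂ z₂ : ℝ → H}
    (h₁ : IsYosidaTrajectory G P Q y₀ v₀ l₁ y₁ z₁) (h₂ : IsYosidaTrajectory G P Q y₀ v₀ l₂ y₂ z₂)
    (ht : 0 ≤ t) (hz₁ : ∀ s ∈ Icc 0 t, ‖z₁ s‖ ≤ Z) (hz₂ : ∀ s ∈ Icc 0 t, ‖z₂ s‖ ≤ Z) :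
    c * ‖y₁ t - y₂ t‖ ^ 2 ≤
      Real.exp ((M + 2 * M ^ 2) / c * t) * (4 * Z ^ 2 * t) * (l₁ + l₂) := by
  have hdist := h.norm_sub_sq_le_of_hasDerivWithinAt (e := 2 * Z ^ 2 * (l₁ + l₂)) ht
    (by positivity) (h₁.continuousOn.mono Icc_subset_Ici_self)
    (h₂.continuousOn.mono Icc_subset_Ici_self) countable_empty
    (fun s hs _ => h₁.hasDerivWithinAt s hs.1) (fun s hs _ => h₂.hasDerivWithinAt s hs.1)
    fun s hs => neg_inner_sub_le_of_sub_smul_mem hG hl₁ hl₂ (h₁.mem s hs.1) (h₂.mem s hs.1)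
      (hz₁ s ⟨hs.1, hs.2.le⟩) (hz₂ s ⟨hs.1, hs.2.le⟩)
  rw [h₁.init, h₂.init, sub_self, norm_zero] at hdist
  linarith

theorem tendsto_inner_velocity [CompleteSpace H] {β : Type*} {F : Filter β} {τ : β → ℝ}
    {y z : β → H} {t C : ℝ} {a v : H} (hτ : Tendsto τ F (𝓝 t)) (hy : Tendsto y F (𝓝 a))
    (hz : ∀ᶠ n in F, ‖z n‖ ≤ C)
    (hv : ∀ w, Tendsto (fun n => (inner ℝ (z n) w : ℝ)) F (𝓝 (inner ℝ v w))) (w : H) :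
    Tendsto (fun n => (inner ℝ (velocity P Q (τ n) (y n) (z n)) w : ℝ)) F
      (𝓝 (inner ℝ (velocity P Q t a v) w)) := by
  have hQ : Tendsto (fun n => Q (τ n)) F (𝓝 (Q t)) := (h.continuous_Q.tendsto t).comp hτ
  have hP : Tendsto (fun n => ContinuousLinearMap.adjoint (P (τ n))) F
      (𝓝 (ContinuousLinearMap.adjoint (P t))) :=
    ((ContinuousLinearMap.adjoint.continuous.comp h.continuous_P).tendsto t).comp hτ
  have hweak := tendsto_inner_of_tendsto_of_tendsto_inner
    (tendsto_clm_apply hP (tendsto_const_nhds (x := w))) hz hv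
  simp only [ContinuousLinearMap.adjoint_inner_right] at hweak
  simpa only [velocity, inner_sub_left] using
    ((tendsto_clm_apply hQ hy).inner tendsto_const_nhds).sub hweak

end EvolutionCoefficients

end WeakSolution

section YosidaLimit

variable {H : Type*} [NormedAddCommGroup H] [InnerProductSpace ℝ H]

namespace EvolutionCoefficients

variable {P Q K : ℝ → H →L[ℝ] H} {M c : ℝ} {G : Set (H × H)} {y₀ v₀ : H}
  (h : EvolutionCoefficients P Q K M c)

include h

theorem continuousOn_inner_velocity {y z : ℝ → H} (hy : ContinuousOn y (Ici 0))
    (hz : ContinuousOn z (Ici 0)) {s t : ℝ} (hs : 0 ≤ s) (w : H) :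
    ContinuousOn (fun r => (inner ℝ (velocity P Q r (y r) (z r)) w : ℝ)) (Icc s t) := by
  have hsub : Icc s t ⊆ Ici 0 := fun r hr => hs.trans hr.1
  exact fun r hr => ((h.continuousWithinAt_velocity (hy r (hsub hr)) (hz r (hsub hr))).inner
    continuousWithinAt_const).mono hsub

theorem inner_sub_eq_integral {y z : ℝ → H} (hyz : IsMonotoneTrajectory P Q y z)
    (hz : ContinuousOn z (Ici 0)) {s t : ℝ} (hs : 0 ≤ s) (hst : s ≤ t) (w : H) :
    (inner ℝ (y t - y s) w : ℝ) = ∫ r in s..t, inner ℝ (velocity P Q r (y r) (z r)) w := by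
  have hcont : ContinuousOn (fun r => (inner ℝ (y r) w : ℝ)) (Icc s t) :=
    (hyz.continuousOn.mono fun r hr => hs.trans hr.1).inner continuousOn_const
  have hint :
      IntervalIntegrable (fun r => (inner ℝ (velocity P Q r (y r) (z r)) w : ℝ)) volume s t :=
    ((h.continuousOn_inner_velocity hyz.continuousOn hz hs w).mono
      (uIcc_of_le hst).subset).intervalIntegrable
  rw [intervalIntegral.integral_eq_sub_of_hasDeriv_right_of_le hst hcont (fun r hr => ?_) hint,
    inner_sub_left]
  simpa using (hyz.hasDerivWithinAt r (hs.trans hr.1.le)).inner ℝ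
    (hasDerivWithinAt_const r (Ioi r) w)

theorem exists_tendsto_of_isYosidaTrajectory [CompleteSpace H] (hG : IsMonotoneGraph G)
    {l : ℕ → ℝ} (hl : ∀ n, 0 < l n) (hl_lim : Tendsto l atTop (𝓝 0)) {y z : ℕ → ℝ → H}
    (hyz : ∀ n, IsYosidaTrajectory G P Q y₀ v₀ (l n) (y n) (z n)) {t Z : ℝ} (ht : 0 ≤ t)
    (hz : ∀ n, ∀ s ∈ Icc 0 t, ‖z n s‖ ≤ Z) : ∃ x, Tendsto (fun n => y n t) atTop (𝓝 x) := by
  refine cauchySeq_tendsto_of_complete (cauchySeq_iff_tendsto_dist_atTop_0.2 ?_)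
  have hsqrt : Tendsto (fun n : ℕ × ℕ => √(Real.exp ((M + 2 * M ^ 2) / c * t) *
      (4 * Z ^ 2 * t) * (l n.1 + l n.2) / c)) atTop (𝓝 0) := by
    rw [← prod_atTop_atTop_eq]
    have hsum := (((hl_lim.comp tendsto_fst).add (hl_lim.comp (tendsto_snd (f := atTop)))).const_mul
      (Real.exp ((M + 2 * M ^ 2) / c * t) * (4 * Z ^ 2 * t))).div_const c
    simpa using hsum.sqrt
  refine squeeze_zero (fun _ => dist_nonneg) (fun n => ?_) hsqrt
  rw [dist_eq_norm]
  exact Real.le_sqrt_of_sq_le ((le_div_iff₀' h.c_pos).2 (h.norm_sub_sq_le_of_isYosidaTrajectory hG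
    (hl n.1).le (hl n.2).le (hyz n.1) (hyz n.2) ht (hz n.1) (hz n.2)))

theorem tendsto_integral_inner_velocity [CompleteSpace H] {yn zn : ℕ → ℝ → H} {y z : ℝ → H}
    {s t Z : ℝ} (hs : 0 ≤ s) (hst : s ≤ t) (hyn : ∀ n, ContinuousOn (yn n) (Ici 0))
    (hzn : ∀ n, ContinuousOn (zn n) (Ici 0))
    (hZ : ∀ n, ∀ r ∈ Icc 0 t, ‖yn n r‖ ≤ Z ∧ ‖zn n r‖ ≤ Z)
    (hy : ∀ r, 0 ≤ r → Tendsto (fun n => yn n r) atTop (𝓝 (y r)))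
    (hz : ∀ r, 0 ≤ r → ∀ w,
      Tendsto (fun n => (inner ℝ (zn n r) w : ℝ)) atTop (𝓝 (inner ℝ (z r) w))) (w : H) :
    Tendsto (fun n => ∫ r in s..t, (inner ℝ (velocity P Q r (yn n r) (zn n r)) w : ℝ)) atTop
      (𝓝 (∫ r in s..t, inner ℝ (velocity P Q r (y r) (z r)) w)) := by
  have hM := h.M_nonneg
  have hsub : ∀ r, r ∈ uIoc s t → r ∈ Icc 0 t := fun r hr => by
    rw [uIoc_of_le hst] at hr
    exact ⟨hs.trans hr.1.le, hr.2⟩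
  refine intervalIntegral.tendsto_integral_filter_of_dominated_convergence
    (fun _ => M * (Z + Z) * ‖w‖) (.of_forall fun n => ?_)
    (.of_forall fun n => .of_forall fun r hr => ?_) intervalIntegrable_const
    (.of_forall fun r hr => ?_)
  · rw [uIoc_of_le hst]
    exact ((h.continuousOn_inner_velocity (hyn n) (hzn n) hs w).aestronglyMeasurable
      measurableSet_Icc).mono_measure (Measure.restrict_mono Ioc_subset_Icc_self le_rfl)
  · obtain ⟨hyr, hzr⟩ := hZ n r (hsub r hr)
    refine (norm_inner_le_norm _ _).trans ?_
    gcongr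
    exact (h.norm_velocity_le _ _ _).trans (by gcongr)
  · have hr0 : 0 ≤ r := (hsub r hr).1
    exact h.tendsto_inner_velocity tendsto_const_nhds (hy r hr0)
      (.of_forall fun n => (hZ n r (hsub r hr)).2) (hz r hr0) w

theorem exists_isWeakSolution [CompleteSpace H] (hG : IsMaximalMonotone G) (hsv : IsSingleValued G)
    (hy₀ : (y₀, v₀) ∈ G) : ∃ y z, y 0 = y₀ ∧ IsWeakSolution G P Q y z := by
  set l : ℕ → ℝ := fun n => 1 / ((n : ℝ) + 1)
  have hl : ∀ n, 0 < l n := fun n => by positivity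
  have hl_lim : Tendsto l atTop (𝓝 0) := tendsto_one_div_add_atTop_nhds_zero_nat
  choose yn zn hyn using fun n => h.exists_isYosidaTrajectory hG hy₀ (hl n)
  choose Z hZ_nonneg hbound using
    h.exists_norm_le (R := max ‖y₀‖ ‖v₀‖) ((norm_nonneg y₀).trans (le_max_left _ _))
  have hZ : ∀ S n, ∀ t ∈ Icc 0 S, ‖yn n t‖ ≤ Z S ∧ ‖zn n t‖ ≤ Z S := fun S n =>
    hbound S _ _ (hyn n).toIsMonotoneTrajectory (hyn n).continuousOn_z
      ((hyn n).init ▸ le_max_left _ _) ((hyn n).norm_init_le.trans (le_max_right _ _))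
  choose! y hy using fun t (ht : 0 ≤ t) => h.exists_tendsto_of_isYosidaTrajectory hG.1 hl hl_lim hyn
    ht fun n s hs => (hZ t n s hs).2
  have hzn : ∀ t, 0 ≤ t → ∀ n, ‖zn n t‖ ≤ Z t := fun t ht n => (hZ t n t ⟨ht, le_rfl⟩).2
  have hlim : ∀ t, 0 ≤ t → Tendsto (fun n => yn n t - l n • zn n t) atTop (𝓝 (y t)) := by
    intro t ht
    have hsmul : Tendsto (fun n => l n • zn n t) atTop (𝓝 0) :=
      hl_lim.zero_smul_isBoundedUnder_le (isBoundedUnder_of ⟨Z t, hzn t ht⟩)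
    simpa using (hy t ht).sub hsmul
  choose! z hzG hz using fun t (ht : 0 ≤ t) => hG.exists_mem_forall_tendsto_inner hsv
    (.of_forall fun n => (hyn n).mem t ht) (hlim t ht) (.of_forall (hzn t ht))
  refine ⟨y, z, ?_, hzG, fun S => ?_, fun s t hs hst w => ?_⟩
  · exact tendsto_nhds_unique (hy 0 le_rfl) (by simp [(hyn _).init])
  · exact ⟨Z S, hZ_nonneg S, fun t ht =>
      ⟨le_of_tendsto (hy t ht.1).norm (.of_forall fun n => (hZ S n t ht).1),
        norm_le_of_tendsto_inner (.of_forall fun n => (hZ S n t ht).2) (hz t ht.1)⟩⟩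
  · refine tendsto_nhds_unique
      (((hy t (hs.trans hst)).sub (hy s hs)).inner tendsto_const_nhds) ?_
    simp only [fun n => h.inner_sub_eq_integral (hyn n).toIsMonotoneTrajectory
      (hyn n).continuousOn_z hs hst w]
    exact h.tendsto_integral_inner_velocity hs hst (fun n => (hyn n).continuousOn)
      (fun n => (hyn n).continuousOn_z) (hZ t) hy hz w

end EvolutionCoefficients

end YosidaLimit

section WeakRegularity

variable {H : Type*} [NormedAddCommGroup H] [InnerProductSpace ℝ H]
  {P Q K : ℝ → H →L[ℝ] H} {M c : ℝ} {G : Set (H × H)} {y z : ℝ → H}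

theorem norm_le_of_forall_inner_le {v : H} {C : ℝ} (hC : 0 ≤ C)
    (h : ∀ w, (inner ℝ v w : ℝ) ≤ C * ‖w‖) : ‖v‖ ≤ C := by
  have hself := h v
  rw [real_inner_self_eq_norm_mul_norm] at hself
  rcases (norm_nonneg v).eq_or_lt with hzero | hpos
  · exact hzero ▸ hC
  · exact le_of_mul_le_mul_right hself hpos

namespace IsWeakSolution

variable (hw : IsWeakSolution G P Q y z)

include hw

theorem exists_norm_sub_le (h : EvolutionCoefficients P Q K M c) (S : ℝ) :
    ∃ L, ∀ s t, 0 ≤ s → s ≤ t → t ≤ S → ‖y t - y s‖ ≤ L * (t - s) := by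
  have hM := h.M_nonneg
  obtain ⟨Z, hZ_nonneg, hZ⟩ := hw.exists_norm_le S
  refine ⟨M * (Z + Z), fun s t hs hst ht => norm_le_of_forall_inner_le ?_ fun w => ?_⟩
  · exact mul_nonneg (by positivity) (sub_nonneg.2 hst)
  rw [hw.inner_sub_eq_integral s t hs hst w, mul_right_comm]
  refine (Real.le_norm_self _).trans
    ((intervalIntegral.norm_integral_le_of_norm_le_const fun r hr => ?_).trans_eq
      (by rw [abs_of_nonneg (sub_nonneg.2 hst)]))
  rw [uIoc_of_le hst] at hr
  obtain ⟨hyr, hzr⟩ := hZ r ⟨hs.trans hr.1.le, hr.2.trans ht⟩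
  refine (norm_inner_le_norm _ _).trans ?_
  gcongr
  exact (h.norm_velocity_le _ _ _).trans (by gcongr)

theorem continuousOn (h : EvolutionCoefficients P Q K M c) : ContinuousOn y (Ici 0) := by
  intro t ht
  obtain ⟨L, hL⟩ := hw.exists_norm_sub_le h (t + 1)
  have hlip : LipschitzOnWith (Real.toNNReal L) y (Icc 0 (t + 1)) := by
    refine .of_dist_le' fun r hr s hs => ?_
    wlog hrs : r ≤ s generalizing r s
    · simpa only [dist_comm] using this s hs r hr (le_of_not_ge hrs)
    rw [dist_comm, dist_comm r, dist_eq_norm, Real.dist_eq, abs_of_nonneg (sub_nonneg.2 hrs)]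
    exact hL r s hr.1 hrs hs.2
  exact (hlip.continuousOn t ⟨ht, (lt_add_one t).le⟩).mono_of_mem_nhdsWithin
    (inter_mem_nhdsWithin _ (Iic_mem_nhds (lt_add_one t)))

variable [CompleteSpace H] (h : EvolutionCoefficients P Q K M c) (hG : IsMaximalMonotone G)
  (hsv : IsSingleValued G)

include h hG hsv

theorem continuousWithinAt_inner_right {t : ℝ} (ht : 0 ≤ t) (w : H) :
    ContinuousWithinAt (fun r => (inner ℝ (z r) w : ℝ)) (Ici 0) t := by
  obtain ⟨Z, -, hZ⟩ := hw.exists_norm_le (t + 1)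
  have hne : (𝓝[Ici 0] t).NeBot := mem_closure_iff_nhdsWithin_neBot.1 (subset_closure ht)
  have hbound : ∀ᶠ s in 𝓝[Ici 0] t, ‖z s‖ ≤ Z := by
    filter_upwards [self_mem_nhdsWithin, nhdsWithin_le_nhds (gt_mem_nhds (lt_add_one t))]
      with s hs hst using (hZ s ⟨hs, hst.le⟩).2
  have hmem : ∀ᶠ s in 𝓝[Ici 0] t, (y s, z s) ∈ G := eventually_mem_nhdsWithin.mono hw.mem
  obtain ⟨v, hv, hvw⟩ :=
    hG.exists_mem_forall_tendsto_inner hsv hmem (hw.continuousOn h t ht) hbound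
  rw [hsv hv (hw.mem t ht)] at hvw
  exact hvw w

theorem continuousWithinAt_inner_velocity {t : ℝ} (ht : 0 ≤ t) (w : H) :
    ContinuousWithinAt (fun r => (inner ℝ (velocity P Q r (y r) (z r)) w : ℝ)) (Ici 0) t := by
  obtain ⟨Z, -, hZ⟩ := hw.exists_norm_le (t + 1)
  refine h.tendsto_inner_velocity (C := Z) (tendsto_id.mono_left nhdsWithin_le_nhds)
    (hw.continuousOn h t ht) ?_ (hw.continuousWithinAt_inner_right h hG hsv ht) w
  filter_upwards [self_mem_nhdsWithin, nhdsWithin_le_nhds (gt_mem_nhds (lt_add_one t))]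
    with s hs hst using (hZ s ⟨hs, hst.le⟩).2

theorem hasWeakRightDeriv {t : ℝ} (ht : 0 ≤ t) :
    HasWeakRightDeriv y (velocity P Q t (y t) (z t)) t := by
  refine ⟨?_, fun w => ?_⟩
  · obtain ⟨L, hL⟩ := hw.exists_norm_sub_le h (t + 1)
    refine ⟨L, ?_⟩
    filter_upwards [Ioo_mem_nhdsGT (lt_add_one t)] with s hs using hL t s ht hs.1.le hs.2.le
  · have hsub : Ioi t ⊆ Ici 0 := fun s hs => ht.trans (le_of_lt hs)
    have hvel : ContinuousOn (fun r => (inner ℝ (velocity P Q r (y r) (z r)) w : ℝ)) (Ici 0) :=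
      fun r hr => hw.continuousWithinAt_inner_velocity h hG hsv hr w
    have hint : HasDerivWithinAt
        (fun s => ∫ r in t..s, (inner ℝ (velocity P Q r (y r) (z r)) w : ℝ))
        (inner ℝ (velocity P Q t (y t) (z t)) w) (Ici t) t :=
      intervalIntegral.integral_hasDerivWithinAt_right .refl
        ((hvel.mono hsub).stronglyMeasurableAtFilter_nhdsWithin measurableSet_Ioi t)
        ((hvel t ht).mono hsub)
    refine ((hint.mono Ioi_subset_Ici_self).const_add (inner ℝ (y t) w)).congr
      (fun s hs => ?_) (by simp)
    rw [← hw.inner_sub_eq_integral t s ht (le_of_lt hs), inner_sub_left, add_sub_cancel]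

end IsWeakSolution

end WeakRegularity

section StrongDerivative

variable {H : Type*} [NormedAddCommGroup H] [InnerProductSpace ℝ H]

theorem inner_map_self_le_of_hasWeakRightDeriv {T : H →L[ℝ] H} (hT : (T : H →ₗ[ℝ] H).IsSymmetric)
    {u f : ℝ → H} {a b B : ℝ} (hab : a ≤ b) (hB : 0 ≤ B) (hu : ContinuousOn u (Icc a b))
    (hf : ∀ t ∈ Ioo a b, HasWeakRightDeriv u (f t) t)
    (hle : ∀ t ∈ Ioo a b, 2 * inner ℝ (T (f t)) (u t) ≤ B) :
    (inner ℝ (T (u b)) (u b) : ℝ) ≤ inner ℝ (T (u a)) (u a) + B * (b - a) := by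
  have hgronwall := gronwall_of_upperRightDiniLE (F := fun t => inner ℝ (T (u t)) (u t)) hab
    le_rfl hB ((continuousOn_const.clm_apply hu).inner hu) (countable_singleton a)
    fun t ht hta => by
      have ht : t ∈ Ioo a b := ⟨ht.1.lt_of_ne' hta, ht.2⟩
      refine ((hf t ht).upperRightDiniLE_energy (K := fun _ => T) (l := 0)
        (fun _ => by simp) hT).mono ?_
      rw [zero_mul, zero_mul, zero_add, zero_add]
      exact hle t ht
  rwa [zero_mul, Real.exp_zero, one_mul] at hgronwall

variable [CompleteSpace H]
  {P Q K : ℝ → H →L[ℝ] H} {M c : ℝ} {G : Set (H × H)} {y z : ℝ → H}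

namespace IsWeakSolution

variable (hw : IsWeakSolution G P Q y z) (h : EvolutionCoefficients P Q K M c)
  (hG : IsMaximalMonotone G) (hsv : IsSingleValued G)

include hw h hG hsv

theorem eventually_inner_remainder_le {s ε : ℝ} (hs : 0 ≤ s) (hε : 0 < ε) :
    ∀ᶠ q in 𝓝[>] s, (inner ℝ (K s (velocity P Q q (y q) (z q) - velocity P Q s (y s) (z s)))
      (y q - y s - (q - s) • velocity P Q s (y s) (z s)) : ℝ) ≤ ε * (q - s) := by
  obtain ⟨L, hL⟩ := hw.exists_norm_sub_le h (s + 1)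
  obtain ⟨Z, hZ_nonneg, hZ⟩ := hw.exists_norm_le (s + 1)
  set f := fun r => velocity P Q r (y r) (z r)
  set D := M ^ 2 * L ^ 2 + M ^ 2 * (Z + Z) * L
  have hsmall : Tendsto (fun q => D * (q - s) +
      (inner ℝ (f s) (K s (f s)) - inner ℝ (f q) (K s (f s)))) (𝓝[>] s) (𝓝 0) := by
    have hlin : Tendsto (fun q => D * (q - s)) (𝓝[>] s) (𝓝 (D * (s - s))) :=
      Tendsto.mono_left (Continuous.tendsto (by fun_prop) s) nhdsWithin_le_nhds
    have hvel : ContinuousWithinAt (fun q => (inner ℝ (f q) (K s (f s)) : ℝ)) (Ioi s) s :=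
      (hw.continuousWithinAt_inner_velocity h hG hsv hs _).mono fun q hq => hs.trans (le_of_lt hq)
    simpa using hlin.add (hvel.tendsto.const_sub (inner ℝ (f s) (K s (f s))))
  filter_upwards [hsmall.eventually_lt_const hε, Ioo_mem_nhdsGT (lt_add_one s)] with q hq hsq
  have hpos : 0 < q - s := sub_pos.2 hsq.1
  have hq0 : 0 ≤ q := hs.trans hsq.1.le
  have hincr := hL s q hs hsq.1.le hsq.2.le
  obtain ⟨hyq, hzq⟩ := hZ q ⟨hq0, hsq.2.le⟩
  have hmono := h.inner_velocity_sub_le q s (neg_nonpos.2 (hG.1 _ (hw.mem q hq0) _ (hw.mem s hs)))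
  rw [abs_of_pos hpos] at hmono
  have hquad : (inner ℝ (K s (f q - f s)) (y q - y s) : ℝ) ≤ D * (q - s) * (q - s) :=
    calc (inner ℝ (K s (f q - f s)) (y q - y s) : ℝ)
        ≤ 0 + M ^ 2 * ‖y q - y s‖ ^ 2 + M ^ 2 * (q - s) * (‖z q‖ + ‖y q‖) * ‖y q - y s‖ := hmono
      _ ≤ 0 + M ^ 2 * (L * (q - s)) ^ 2 + M ^ 2 * (q - s) * (Z + Z) * (L * (q - s)) := by gcongr
      _ = D * (q - s) * (q - s) := by ring
  have hsym : (inner ℝ (K s (f q - f s)) (f s) : ℝ) =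
      inner ℝ (f q) (K s (f s)) - inner ℝ (f s) (K s (f s)) := by
    rw [← inner_sub_left]
    exact h.symm s _ _
  rw [inner_sub_right, inner_smul_right, hsym]
  linarith [mul_le_mul_of_nonneg_right hq.le hpos.le]

theorem hasDerivWithinAt_Ioi {s : ℝ} (hs : 0 ≤ s) :
    HasDerivWithinAt y (velocity P Q s (y s) (z s)) (Ioi s) s := by
  have hc := h.c_pos
  rw [hasDerivWithinAt_iff_isLittleO, Asymptotics.isLittleO_iff]
  intro η hη
  set f := velocity P Q s (y s) (z s)
  set d := fun r => y r - y s - (r - s) • f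
  obtain ⟨a, hsa, ha⟩ := (mem_nhdsGT_iff_exists_Ioo_subset).1
    (hw.eventually_inner_remainder_le h hG hsv hs (by positivity : 0 < c * η ^ 2 / 2))
  filter_upwards [Ioo_mem_nhdsGT hsa] with q hq
  have hpos : 0 < q - s := sub_pos.2 hq.1
  have hd : ContinuousOn d (Icc s q) :=
    ((hw.continuousOn h).mono fun r hr => hs.trans hr.1).sub continuousOn_const |>.sub
      (by fun_prop)
  have hd_deriv : ∀ r ∈ Ioo s q,
      HasWeakRightDeriv d (velocity P Q r (y r) (z r) - f) r := fun r hr => by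
    have hlin : HasDerivWithinAt (fun r => (r - s) • f) f (Ioi r) r := by
      simpa using (((hasDerivAt_id r).sub_const s).smul_const f).hasDerivWithinAt
    exact ((hw.hasWeakRightDeriv h hG hsv (hs.trans hr.1.le)).sub_const (y s)).sub
      (.of_hasDerivWithinAt hlin)
  have henergy := inner_map_self_le_of_hasWeakRightDeriv (h.symm s) (B := c * η ^ 2 * (q - s))
    hq.1.le (by positivity) hd hd_deriv fun r hr => by
      have hrem : (inner ℝ (K s (velocity P Q r (y r) (z r) - f)) (d r) : ℝ) ≤
          c * η ^ 2 / 2 * (r - s) := ha ⟨hr.1, hr.2.trans hq.2⟩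
      have hrq : c * η ^ 2 * (r - s) ≤ c * η ^ 2 * (q - s) := by gcongr; exact hr.2.le
      linarith
  have hnorm : c * ‖d q‖ ^ 2 ≤ c * (η * (q - s)) ^ 2 := by
    refine (h.coercive s (d q)).trans (henergy.trans_eq ?_)
    simp only [d, sub_self, zero_smul, map_zero, inner_zero_left]
    ring
  rw [Real.norm_of_nonneg hpos.le]
  exact (sq_le_sq₀ (norm_nonneg _) (by positivity)).1 (le_of_mul_le_mul_left hnorm hc)

theorem isMonotoneTrajectory : IsMonotoneTrajectory P Q y z :=
  ⟨hw.continuousOn h, fun _ ht => hw.hasDerivWithinAt_Ioi h hG hsv ht,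
    fun s t hs ht => hG.1 _ (hw.mem s hs) _ (hw.mem t ht)⟩

end IsWeakSolution

end StrongDerivative

/-- `E` satisfies, on every bounded interval, the growth estimate produced by Gronwall's lemma with
the exponential rate `C` and a source depending on the interval. -/
def HasGronwallGrowth (C : ℝ) (E : ℝ → ℝ) : Prop :=
  ∀ S, ∃ B, 0 ≤ B ∧ ∀ s t, 0 ≤ s → s ≤ t → t ≤ S →
    E t ≤ Real.exp (C * (t - s)) * (E s + B * (t - s))

theorem antitoneOn_exp_mul_sub {E : ℝ → ℝ} {C B S : ℝ} (hC : 0 ≤ C) (hB : 0 ≤ B)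
    (hE : ∀ s t, 0 ≤ s → s ≤ t → t ≤ S → E t ≤ Real.exp (C * (t - s)) * (E s + B * (t - s))) :
    AntitoneOn (fun t => Real.exp (-(C * t)) * E t - B * t) (Icc 0 S) := by
  intro s hs t ht hst
  have hgrowth := mul_le_mul_of_nonneg_left (hE s t hs.1 hst ht.2) (Real.exp_pos (-(C * t))).le
  rw [← mul_assoc, ← Real.exp_add, (by ring : -(C * t) + C * (t - s) = -(C * s))] at hgrowth
  have hexp : Real.exp (-(C * s)) * (B * (t - s)) ≤ B * (t - s) :=
    mul_le_of_le_one_left (mul_nonneg hB (sub_nonneg.2 hst))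
      (Real.exp_le_one_iff.2 (neg_nonpos.2 (mul_nonneg hC hs.1)))
  simp only
  linarith

theorem HasGronwallGrowth.countable_not_continuousWithinAt {E : ℝ → ℝ} {C : ℝ} (hC : 0 ≤ C)
    (hE : HasGronwallGrowth C E) : {t | 0 ≤ t ∧ ¬ContinuousWithinAt E (Ici 0) t}.Countable := by
  choose B hB hE using hE
  refine Countable.mono ?_ (countable_iUnion fun n : ℕ =>
    (antitoneOn_exp_mul_sub hC (hB n) (hE n)).countable_not_continuousWithinAt)
  rintro t ⟨ht, hdisc⟩
  obtain ⟨n, hn⟩ := exists_nat_gt t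
  refine mem_iUnion.2 ⟨n, ⟨ht, hn.le⟩, fun hcont => hdisc ?_⟩
  have hcont : ContinuousWithinAt (fun t => Real.exp (-(C * t)) * E t - B n * t) (Ici 0) t :=
    hcont.mono_of_mem_nhdsWithin (inter_mem_nhdsWithin _ (Iic_mem_nhds hn))
  have hrecover : E = fun t =>
      Real.exp (C * t) * (Real.exp (-(C * t)) * E t - B n * t + B n * t) := by
    funext t
    rw [sub_add_cancel, ← mul_assoc, ← Real.exp_add, add_neg_cancel, Real.exp_zero, one_mul]
  rw [hrecover]
  exact ContinuousWithinAt.mul (by fun_prop) (hcont.add (by fun_prop))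

section RightDerivative

variable {E : Type*} [NormedAddCommGroup E] [NormedSpace ℝ E] {u f : ℝ → E} {a b : ℝ}

theorem norm_sub_sub_smul_le_of_hasDerivWithinAt_Ioi {v : E} {ε : ℝ} (hab : a ≤ b)
    (hu : ContinuousOn u (Icc a b)) (hderiv : ∀ t ∈ Ico a b, HasDerivWithinAt u (f t) (Ioi t) t)
    (hf : ∀ t ∈ Ico a b, ‖f t - v‖ ≤ ε) : ‖u b - u a - (b - a) • v‖ ≤ ε * (b - a) := by
  have hlin : ∀ t, HasDerivAt (fun t : ℝ => t • v) v t := fun t => by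
    simpa using (hasDerivAt_id' t).smul_const v
  have hsegment := norm_image_sub_le_of_norm_deriv_right_le_segment
    (hu.sub (by fun_prop : ContinuousOn (fun t : ℝ => t • v) (Icc a b)))
    (fun t ht => (hderiv t ht).Ici_of_Ioi.sub (hlin t).hasDerivWithinAt) hf b
    (right_mem_Icc.2 hab)
  simp only [Pi.sub_apply] at hsegment
  rwa [sub_sub_sub_comm, ← sub_smul] at hsegment

theorem hasDerivWithinAt_Ici_of_hasDerivWithinAt_Ioi {t : ℝ} (ht : a ≤ t)
    (hu : ContinuousOn u (Ici a)) (hderiv : ∀ t, a ≤ t → HasDerivWithinAt u (f t) (Ioi t) t)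
    (hf : ContinuousWithinAt f (Ici a) t) : HasDerivWithinAt u (f t) (Ici a) t := by
  rw [hasDerivWithinAt_iff_isLittleO, Asymptotics.isLittleO_iff]
  intro ε hε
  obtain ⟨δ, hδ, hclose⟩ := Metric.continuousWithinAt_iff.1 hf ε hε
  have hmean : ∀ p q, a ≤ p → p ≤ q → Ico p q ⊆ Metric.ball t δ →
      ‖u q - u p - (q - p) • f t‖ ≤ ε * (q - p) := fun p q hp hpq hball =>
    norm_sub_sub_smul_le_of_hasDerivWithinAt_Ioi hpq (hu.mono fun r hr => hp.trans hr.1)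
      (fun r hr => hderiv r (hp.trans hr.1))
      fun r hr => (dist_eq_norm (f r) (f t) ▸ hclose (hp.trans hr.1) (hball hr)).le
  filter_upwards [self_mem_nhdsWithin, nhdsWithin_le_nhds (Metric.ball_mem_nhds t hδ)]
    with s hs hst
  have hconvex := (convex_ball t δ).ordConnected
  rcases le_total t s with hts | hts
  · rw [Real.norm_of_nonneg (sub_nonneg.2 hts)]
    exact hmean t s ht hts
      (Ico_subset_Icc_self.trans (hconvex.out (Metric.mem_ball_self hδ) hst))
  · rw [← norm_neg, norm_sub_rev s t, Real.norm_of_nonneg (sub_nonneg.2 hts),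
      (by module : -(u s - u t - (s - t) • f t) = u t - u s - (t - s) • f t)]
    exact hmean s t hs hts
      (Ico_subset_Icc_self.trans (hconvex.out hst (Metric.mem_ball_self hδ)))

end RightDerivative

section ContinuityPoints

variable {H : Type*} [NormedAddCommGroup H] [InnerProductSpace ℝ H]

theorem tendsto_inner_map_self_sub {β : Type*} {F : Filter β} {T : β → H →L[ℝ] H} {T₀ : H →L[ℝ] H}
    {u : β → H} {u₀ : H} {C : ℝ} (hT : Tendsto T F (𝓝 T₀))
    (hsymm : ∀ n, (T n : H →ₗ[ℝ] H).IsSymmetric) (hu : ∀ᶠ n in F, ‖u n‖ ≤ C)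
    (hweak : ∀ w, Tendsto (fun n => (inner ℝ (u n) w : ℝ)) F (𝓝 (inner ℝ u₀ w)))
    (henergy : Tendsto (fun n => (inner ℝ (T n (u n)) (u n) : ℝ)) F (𝓝 (inner ℝ (T₀ u₀) u₀))) :
    Tendsto (fun n => (inner ℝ (T n (u n - u₀)) (u n - u₀) : ℝ)) F (𝓝 0) := by
  have hTu₀ : Tendsto (fun n => T n u₀) F (𝓝 (T₀ u₀)) :=
    tendsto_clm_apply hT tendsto_const_nhds
  have hcross : Tendsto (fun n => (inner ℝ (u n) (T n u₀) : ℝ)) F (𝓝 (inner ℝ u₀ (T₀ u₀))) :=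
    tendsto_inner_of_tendsto_of_tendsto_inner hTu₀ hu hweak
  have hlim := (henergy.sub (hcross.const_mul 2)).add (hTu₀.inner (tendsto_const_nhds (x := u₀)))
  have hzero : (inner ℝ (T₀ u₀) u₀ : ℝ) - 2 * inner ℝ u₀ (T₀ u₀) + inner ℝ (T₀ u₀) u₀ = 0 := by
    rw [real_inner_comm (T₀ u₀) u₀]
    ring
  rw [hzero] at hlim
  refine hlim.congr fun n => ?_
  have hsym : (inner ℝ (T n (u n)) u₀ : ℝ) = inner ℝ (u n) (T n u₀) := hsymm n _ _
  rw [map_sub, inner_sub_left, inner_sub_right, inner_sub_right, hsym,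
    real_inner_comm (u n) (T n u₀)]
  ring

variable {P Q K : ℝ → H →L[ℝ] H} {M c : ℝ} {G : Set (H × H)} {y z : ℝ → H}

theorem EvolutionCoefficients.continuousWithinAt_of_velocity (h : EvolutionCoefficients P Q K M c)
    {s : Set ℝ} {t : ℝ} (hy : ContinuousWithinAt y s t)
    (hvel : ContinuousWithinAt (fun r => velocity P Q r (y r) (z r)) s t) :
    ContinuousWithinAt z s t := by
  rw [funext fun r => h.eq_map_sub_velocity r (y r) (z r)]
  exact h.continuous_K.continuousWithinAt.clm_apply
    ((h.continuous_Q.continuousWithinAt.clm_apply hy).sub hvel)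

namespace IsWeakSolution

variable [CompleteSpace H] (hw : IsWeakSolution G P Q y z) (h : EvolutionCoefficients P Q K M c)
  (hG : IsMaximalMonotone G) (hsv : IsSingleValued G)

include hw h hG hsv

theorem hasGronwallGrowth_kineticEnergy :
    HasGronwallGrowth (growthRate M c) (kineticEnergy P Q K y z) := by
  intro S
  obtain ⟨Z, -, hZ⟩ := hw.exists_norm_le (S + 1)
  refine ⟨(M ^ 2 * (Z + Z)) ^ 2, by positivity, fun s t hs hst htS =>
    h.kineticEnergy_le (hw.isMonotoneTrajectory h hG hsv) hs hst ?_⟩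
  filter_upwards [Ioo_mem_nhdsGT one_pos] with r hr q hq
  obtain ⟨hy, hz⟩ := hZ (q + r) ⟨by linarith [hq.1, hr.1], by linarith [hq.2, hr.2]⟩
  gcongr

theorem continuousWithinAt_of_kineticEnergy {t : ℝ} (ht : 0 ≤ t)
    (hE : ContinuousWithinAt (kineticEnergy P Q K y z) (Ici 0) t) :
    ContinuousWithinAt z (Ici 0) t := by
  have hM := h.M_nonneg
  have hc := h.c_pos
  obtain ⟨Z, -, hZ⟩ := hw.exists_norm_le (t + 1)
  set f := fun r => velocity P Q r (y r) (z r)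
  have hbound : ∀ᶠ r in 𝓝[Ici 0] t, ‖f r‖ ≤ M * (Z + Z) := by
    filter_upwards [self_mem_nhdsWithin, nhdsWithin_le_nhds (gt_mem_nhds (lt_add_one t))]
      with s hs hst
    obtain ⟨hys, hzs⟩ := hZ s ⟨hs, hst.le⟩
    exact (h.norm_velocity_le _ _ _).trans (by gcongr)
  have henergy := (tendsto_inner_map_self_sub h.continuous_K.continuousWithinAt h.symm hbound
    (hw.continuousWithinAt_inner_velocity h hG hsv ht) hE).div_const c
  rw [zero_div] at henergy
  have hsq : Tendsto (fun r => ‖f r - f t‖ ^ 2) (𝓝[Ici 0] t) (𝓝 0) :=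
    squeeze_zero (fun _ => sq_nonneg _)
      (fun r => (le_div_iff₀' hc).2 (h.coercive r _)) henergy
  have hf : ContinuousWithinAt f (Ici 0) t :=
    tendsto_iff_norm_sub_tendsto_zero.2 (by simpa using hsq.sqrt)
  exact h.continuousWithinAt_of_velocity (hw.continuousOn h t ht) hf

theorem exists_countable_forall_hasDerivWithinAt : ∃ N : Set ℝ, N.Countable ∧
    ∀ t, 0 ≤ t → t ∉ N → HasDerivWithinAt y (velocity P Q t (y t) (z t)) (Ici 0) t ∧
      ContinuousWithinAt z (Ici 0) t := by
  refine ⟨_, (hw.hasGronwallGrowth_kineticEnergy h hG hsv).countable_not_continuousWithinAt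
    h.growthRate_nonneg, fun t ht htN => ?_⟩
  have hz := hw.continuousWithinAt_of_kineticEnergy h hG hsv ht
    (not_not.1 fun hdisc => htN ⟨ht, hdisc⟩)
  exact ⟨hasDerivWithinAt_Ici_of_hasDerivWithinAt_Ioi
    (f := fun r => velocity P Q r (y r) (z r)) ht (hw.continuousOn h)
    (fun r hr => hw.hasDerivWithinAt_Ioi h hG hsv hr)
    (h.continuousWithinAt_velocity (hw.continuousOn h t ht) hz), hz⟩

end IsWeakSolution

end ContinuityPoints

section LocallyLipschitz

variable {α E F : Type*} [PseudoEMetricSpace α] [NormedAddCommGroup E] {a b : ℝ}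

theorem locallyLipschitzOn_prodMk {β γ : Type*} [PseudoEMetricSpace β]
    [PseudoEMetricSpace γ] {f : α → β} {g : α → γ} {s : Set α}
    (hf : LocallyLipschitzOn s f) (hg : LocallyLipschitzOn s g) :
    LocallyLipschitzOn s fun t => (f t, g t) := by
  intro t ht
  obtain ⟨L, u, hu, hfu⟩ := hf ht
  obtain ⟨L', v, hv, hgv⟩ := hg ht
  exact ⟨_, u ∩ v, inter_mem hu hv,
    (hfu.mono inter_subset_left).prodMk (hgv.mono inter_subset_right)⟩

theorem LocallyLipschitzInTime.locallyLipschitzOn {f : ℝ → E} (hf : LocallyLipschitzInTime f) :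
    LocallyLipschitzOn (Ici 0) f := by
  intro t ht
  obtain ⟨ν, hν, hlip⟩ := hf (t + 1) (add_pos_of_nonneg_of_pos ht one_pos)
  refine ⟨⟨ν, hν.le⟩, Icc 0 (t + 1), inter_mem self_mem_nhdsWithin
    (nhdsWithin_le_nhds (Iic_mem_nhds (lt_add_one t))), .of_dist_le_mul fun r hr s hs => ?_⟩
  rw [dist_eq_norm, dist_eq_norm]
  exact hlip s hs r hr

theorem exists_norm_projIcc_le_and_lipschitz {f : ℝ → E} (hab : a ≤ b)
    (hf : LocallyLipschitzOn (Icc a b) f) : ∃ M, 0 ≤ M ∧ (∀ t, ‖f (projIcc a b hab t)‖ ≤ M) ∧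
      ∀ s t, ‖f (projIcc a b hab s) - f (projIcc a b hab t)‖ ≤ M * |s - t| := by
  obtain ⟨L, hL⟩ := hf.exists_lipschitzOnWith_of_compact isCompact_Icc
  obtain ⟨R, hR⟩ := isCompact_Icc.exists_bound_of_continuousOn hf.continuousOn
  refine ⟨max R L, le_max_of_le_right L.2, fun t => (hR _ (Subtype.prop _)).trans (le_max_left _ _),
    fun s t => ?_⟩
  calc ‖f (projIcc a b hab s) - f (projIcc a b hab t)‖
      ≤ L * |(projIcc a b hab s : ℝ) - projIcc a b hab t| := by
        rw [← Real.norm_eq_abs]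
        exact hL.norm_sub_le (Subtype.prop _) (Subtype.prop _)
    _ ≤ max R L * |s - t| :=
        mul_le_mul (le_max_right _ _) (abs_projIcc_sub_projIcc hab) (abs_nonneg _)
          (le_max_of_le_right L.2)

variable [NormedAddCommGroup F] [NormedSpace ℝ E] [NormedSpace ℝ F]

theorem locallyLipschitzOn_of_contDiffOn {f : E → F} {s : Set E} (hf : ContDiffOn ℝ 1 f s)
    (hs : Convex ℝ s) : LocallyLipschitzOn s f :=
  fun _ hx => (hf _ hx).exists_lipschitzOnWith hs

theorem locallyLipschitzOn_comp_of_contDiffAt {Φ : E → F} {f : α → E} {s : Set α}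
    (hΦ : ∀ t ∈ s, ContDiffAt ℝ 1 Φ (f t)) (hf : LocallyLipschitzOn s f) :
    LocallyLipschitzOn s fun t => Φ (f t) := by
  intro t ht
  obtain ⟨L, u, hu, hΦu⟩ := (hΦ t ht).exists_lipschitzOnWith
  obtain ⟨L', v, hv, hfv⟩ := hf ht
  exact ⟨L * L', v ∩ f ⁻¹' u, inter_mem hv (hf.continuousOn t ht hu),
    hΦu.comp (hfv.mono inter_subset_left) fun _ hr => hr.2⟩

theorem locallyLipschitzOn_const_smul {f : α → E} {s : Set α} (r : ℝ)
    (hf : LocallyLipschitzOn s f) : LocallyLipschitzOn s fun t => r • f t :=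
  locallyLipschitzOn_comp_of_contDiffAt (fun _ _ => (contDiff_const_smul r).contDiffAt) hf

theorem locallyLipschitzOn_mul {f g : α → E →L[ℝ] E} {s : Set α}
    (hf : LocallyLipschitzOn s f) (hg : LocallyLipschitzOn s g) :
    LocallyLipschitzOn s fun t => f t * g t :=
  locallyLipschitzOn_comp_of_contDiffAt (Φ := fun p => p.1 * p.2)
    (fun _ _ => contDiffAt_fst.mul contDiffAt_snd) (locallyLipschitzOn_prodMk hf hg)

variable [CompleteSpace E]

theorem locallyLipschitzOn_inverse {f : α → E →L[ℝ] E} {s : Set α}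
    (hf : LocallyLipschitzOn s f) (hinv : ∀ t ∈ s, (f t).IsInvertible) :
    LocallyLipschitzOn s fun t => (f t).inverse :=
  locallyLipschitzOn_comp_of_contDiffAt (fun t ht => (hinv t ht).contDiffAt_map_inverse) hf

theorem continuousWithinAt_inverse {f : ℝ → E →L[ℝ] E} {s : Set ℝ} {t : ℝ}
    (hf : ContinuousWithinAt f s t) (hinv : (f t).IsInvertible) :
    ContinuousWithinAt (fun r => (f r).inverse) s t :=
  (hinv.contDiffAt_map_inverse (n := 0)).continuousAt.comp_continuousWithinAt hf

theorem hasDerivWithinAt_inverse {f : ℝ → E →L[ℝ] E} {f' : E →L[ℝ] E}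
    {s : Set ℝ} {t : ℝ} (hf : HasDerivWithinAt f f' s t) (hinv : (f t).IsInvertible) :
    HasDerivWithinAt (fun r => (f r).inverse) (-((f t).inverse * f' * (f t).inverse)) s t := by
  obtain ⟨e, he⟩ := hinv
  have hderiv := hasFDerivAt_ringInverse (𝕜 := ℝ) (ContinuousLinearEquiv.toUnit e)
  rw [ContinuousLinearMap.ringInverse_eq_inverse] at hderiv
  refine (hderiv.comp_hasDerivWithinAt_of_eq t hf he).congr_deriv ?_
  rw [← he, ContinuousLinearMap.inverse_equiv]
  rfl

end LocallyLipschitz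

section LocalCoefficients

variable {H : Type*} [NormedAddCommGroup H] [InnerProductSpace ℝ H]

/-- The coefficients of `y' = Q(t) y - P(t) z` on `[0, ∞)`, subject on each bounded interval to the
uniform bounds of `EvolutionCoefficients`. -/
structure LocalEvolutionCoefficients (P Q K : ℝ → H →L[ℝ] H) : Prop where
  P_lip : LocallyLipschitzOn (Ici 0) P
  Q_lip : LocallyLipschitzOn (Ici 0) Q
  K_lip : LocallyLipschitzOn (Ici 0) K
  symm : ∀ t, 0 ≤ t → (K t : H →ₗ[ℝ] H).IsSymmetric
  coercive : ∀ T, 0 < T → ∃ c, 0 < c ∧ ∀ t ∈ Icc 0 T, ∀ x, c * ‖x‖ ^ 2 ≤ inner ℝ (K t x) x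
  left_inv : ∀ t, 0 ≤ t → ∀ x, K t (P t x) = x

theorem LocalEvolutionCoefficients.exists_evolutionCoefficients {P Q K : ℝ → H →L[ℝ] H}
    (h : LocalEvolutionCoefficients P Q K) {T : ℝ} (hT : 0 < T) : ∃ P' Q' K' M c,
      EvolutionCoefficients P' Q' K' M c ∧ EqOn P' P (Icc 0 T) ∧ EqOn Q' Q (Icc 0 T) := by
  obtain ⟨M₁, hM₁, hP, hP_lip⟩ :=
    exists_norm_projIcc_le_and_lipschitz hT.le (h.P_lip.mono Icc_subset_Ici_self)
  obtain ⟨M₂, hM₂, hQ, hQ_lip⟩ :=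
    exists_norm_projIcc_le_and_lipschitz hT.le (h.Q_lip.mono Icc_subset_Ici_self)
  obtain ⟨M₃, hM₃, hK, hK_lip⟩ :=
    exists_norm_projIcc_le_and_lipschitz hT.le (h.K_lip.mono Icc_subset_Ici_self)
  obtain ⟨c, hc, hcoercive⟩ := h.coercive T hT
  have hM₁_le : M₁ ≤ M₁ + M₂ + M₃ := by linarith
  have hM₂_le : M₂ ≤ M₁ + M₂ + M₃ := by linarith
  have hM₃_le : M₃ ≤ M₁ + M₂ + M₃ := by linarith
  have hmem : ∀ t, (projIcc 0 T hT.le t : ℝ) ∈ Icc 0 T := fun t => Subtype.prop _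
  have hproj : ∀ t ∈ Icc 0 T, (projIcc 0 T hT.le t : ℝ) = t := fun t ht => by
    rw [projIcc_of_mem hT.le ht]
  refine ⟨fun t => P (projIcc 0 T hT.le t), fun t => Q (projIcc 0 T hT.le t),
    fun t => K (projIcc 0 T hT.le t), M₁ + M₂ + M₃, c, ?_, fun t ht => congrArg P (hproj t ht),
    fun t ht => congrArg Q (hproj t ht)⟩
  exact
    { M_nonneg := by positivity
      c_pos := hc
      P_le := fun t => (hP t).trans hM₁_le
      Q_le := fun t => (hQ t).trans hM₂_le
      K_le := fun t => (hK t).trans hM₃_le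
      P_lip := fun s t => (hP_lip s t).trans (by gcongr)
      Q_lip := fun s t => (hQ_lip s t).trans (by gcongr)
      K_lip := fun s t => (hK_lip s t).trans (by gcongr)
      symm := fun t => h.symm _ (hmem t).1
      coercive := fun t => hcoercive _ (hmem t)
      left_inv := fun t => h.left_inv _ (hmem t).1 }

end LocalCoefficients

section StrongSolution

variable {H : Type*} [NormedAddCommGroup H] [InnerProductSpace ℝ H]

/-- `y` is a strong solution of `y' = Q(t) y - P(t) z`, `z ∈ G y`, on the time interval `I`: the
equation holds, with `z` continuous, at all but countably many times. -/
structure IsStrongSolutionOn (G : Set (H × H)) (P Q : ℝ → H →L[ℝ] H) (I : Set ℝ)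
    (y z : ℝ → H) : Prop where
  continuousOn : ContinuousOn y I
  mem : ∀ t ∈ I, (y t, z t) ∈ G
  exists_countable : ∃ N : Set ℝ, N.Countable ∧ ∀ t ∈ I, t ∉ N →
    HasDerivWithinAt y (velocity P Q t (y t) (z t)) I t ∧ ContinuousWithinAt z I t

variable {G : Set (H × H)} {P Q K P' Q' : ℝ → H →L[ℝ] H} {I J : Set ℝ} {y z y' z' : ℝ → H}

namespace IsStrongSolutionOn

theorem mono (h : IsStrongSolutionOn G P Q I y z) (hJI : J ⊆ I) :
    IsStrongSolutionOn G P Q J y z := by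
  obtain ⟨N, hN, hderiv⟩ := h.exists_countable
  exact ⟨h.continuousOn.mono hJI, fun t ht => h.mem t (hJI ht), N, hN, fun t ht htN =>
    ⟨(hderiv t (hJI ht) htN).1.mono hJI, (hderiv t (hJI ht) htN).2.mono hJI⟩⟩

theorem congr (h : IsStrongSolutionOn G P Q I y z) (hy : EqOn y' y I) (hz : EqOn z' z I) :
    IsStrongSolutionOn G P Q I y' z' := by
  obtain ⟨N, hN, hderiv⟩ := h.exists_countable
  refine ⟨h.continuousOn.congr hy, fun t ht => ?_, N, hN, fun t ht htN => ⟨?_, ?_⟩⟩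
  · rw [hy ht, hz ht]
    exact h.mem t ht
  · rw [hy ht, hz ht]
    exact (hderiv t ht htN).1.congr hy (hy ht)
  · exact (hderiv t ht htN).2.congr hz (hz ht)

theorem congr_coefficients (h : IsStrongSolutionOn G P Q I y z) (hP : EqOn P' P I)
    (hQ : EqOn Q' Q I) : IsStrongSolutionOn G P' Q' I y z := by
  obtain ⟨N, hN, hderiv⟩ := h.exists_countable
  refine ⟨h.continuousOn, h.mem, N, hN, fun t ht htN => ⟨?_, (hderiv t ht htN).2⟩⟩
  rw [velocity, hP ht, hQ ht]
  exact (hderiv t ht htN).1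

theorem of_forall_Icc (h : ∀ n : ℕ, IsStrongSolutionOn G P Q (Icc 0 ((n : ℝ) + 1)) y z) :
    IsStrongSolutionOn G P Q (Ici 0) y z := by
  have hmem : ∀ t ∈ Ici (0 : ℝ), t ∈ Icc 0 ((⌊t⌋₊ : ℝ) + 1) := fun t ht =>
    ⟨ht, (Nat.lt_floor_add_one t).le⟩
  have hnhds : ∀ t : ℝ, Icc 0 ((⌊t⌋₊ : ℝ) + 1) ∈ 𝓝[Ici 0] t := fun t =>
    inter_mem self_mem_nhdsWithin (nhdsWithin_le_nhds (Iic_mem_nhds (Nat.lt_floor_add_one t)))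
  choose N hN hderiv using fun n => (h n).exists_countable
  refine ⟨fun t ht => ((h _).continuousOn t (hmem t ht)).mono_of_mem_nhdsWithin (hnhds t),
    fun t ht => (h _).mem t (hmem t ht), ⋃ n, N n, countable_iUnion hN, fun t ht htN => ?_⟩
  obtain ⟨hy, hz⟩ := hderiv ⌊t⌋₊ t (hmem t ht) fun htn => htN (mem_iUnion.2 ⟨_, htn⟩)
  exact ⟨hy.mono_of_mem_nhdsWithin (hnhds t), hz.mono_of_mem_nhdsWithin (hnhds t)⟩

end IsStrongSolutionOn

theorem EvolutionCoefficients.eq_of_isStrongSolutionOn {M c T : ℝ}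
    (h : EvolutionCoefficients P Q K M c) (hG : IsMonotoneGraph G) (hT : 0 ≤ T)
    (hy : IsStrongSolutionOn G P Q (Icc 0 T) y z) (hy' : IsStrongSolutionOn G P Q (Icc 0 T) y' z')
    (h₀ : y 0 = y' 0) : y T = y' T := by
  obtain ⟨N, hN, hderiv⟩ := hy.exists_countable
  obtain ⟨N', hN', hderiv'⟩ := hy'.exists_countable
  have hnhds : ∀ t ∈ Ico 0 T, Icc 0 T ∈ 𝓝[>] t := fun t ht => Icc_mem_nhdsGT_of_mem ht
  have hle := h.norm_sub_sq_le_of_hasDerivWithinAt hT le_rfl hy.continuousOn hy'.continuousOn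
    (hN.union hN')
    (fun t ht htN => (hderiv t (Ico_subset_Icc_self ht) fun htn => htN (.inl htn)).1
      |>.mono_of_mem_nhdsWithin (hnhds t ht))
    (fun t ht htN => (hderiv' t (Ico_subset_Icc_self ht) fun htn => htN (.inr htn)).1
      |>.mono_of_mem_nhdsWithin (hnhds t ht))
    fun t ht => neg_nonpos.2 (hG _ (hy.mem t (Ico_subset_Icc_self ht)) _
      (hy'.mem t (Ico_subset_Icc_self ht)))
  rw [h₀, sub_self, norm_zero] at hle
  have hsq : ‖y T - y' T‖ ^ 2 ≤ 0 := by
    refine nonpos_of_mul_nonpos_right (hle.trans_eq ?_) h.c_pos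
    ring
  have hnorm : ‖y T - y' T‖ = 0 := (pow_eq_zero_iff two_ne_zero).1 (hsq.antisymm (sq_nonneg _))
  exact sub_eq_zero.1 (norm_eq_zero.1 hnorm)

namespace LocalEvolutionCoefficients

variable (h : LocalEvolutionCoefficients P Q K)

include h

theorem eqOn_Icc_of_isStrongSolutionOn (hG : IsMonotoneGraph G) {T : ℝ}
    (hy : IsStrongSolutionOn G P Q (Icc 0 T) y z) (hy' : IsStrongSolutionOn G P Q (Icc 0 T) y' z')
    (h₀ : y 0 = y' 0) : EqOn y y' (Icc 0 T) := by
  intro t ht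
  obtain rfl | ht_pos := ht.1.eq_or_lt
  · exact h₀
  have hsub : Icc 0 t ⊆ Icc 0 T := Icc_subset_Icc_right ht.2
  obtain ⟨P', Q', K', M, c, hcoef, hP, hQ⟩ := h.exists_evolutionCoefficients ht_pos
  exact hcoef.eq_of_isStrongSolutionOn hG ht_pos.le ((hy.mono hsub).congr_coefficients hP hQ)
    ((hy'.mono hsub).congr_coefficients hP hQ) h₀

theorem eqOn_Ici_of_isStrongSolutionOn (hG : IsMonotoneGraph G)
    (hy : IsStrongSolutionOn G P Q (Ici 0) y z) (hy' : IsStrongSolutionOn G P Q (Ici 0) y' z')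
    (h₀ : y 0 = y' 0) : EqOn y y' (Ici 0) := fun _ ht =>
  h.eqOn_Icc_of_isStrongSolutionOn hG (hy.mono Icc_subset_Ici_self) (hy'.mono Icc_subset_Ici_self)
    h₀ (right_mem_Icc.2 ht)

variable [CompleteSpace H]

theorem exists_isStrongSolutionOn_Icc (hG : IsMaximalMonotone G) (hsv : IsSingleValued G)
    {y₀ v₀ : H} (hy₀ : (y₀, v₀) ∈ G) {T : ℝ} (hT : 0 < T) :
    ∃ y z, y 0 = y₀ ∧ IsStrongSolutionOn G P Q (Icc 0 T) y z := by
  obtain ⟨P', Q', K', M, c, hcoef, hP, hQ⟩ := h.exists_evolutionCoefficients hT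
  obtain ⟨y, z, hinit, hw⟩ := hcoef.exists_isWeakSolution hG hsv hy₀
  have hstrong : IsStrongSolutionOn G P' Q' (Ici 0) y z :=
    ⟨hw.continuousOn hcoef, hw.mem, hw.exists_countable_forall_hasDerivWithinAt hcoef hG hsv⟩
  exact ⟨y, z, hinit, (hstrong.mono Icc_subset_Ici_self).congr_coefficients hP.symm hQ.symm⟩

theorem exists_isStrongSolutionOn_Ici (hG : IsMaximalMonotone G) (hsv : IsSingleValued G)
    {y₀ v₀ : H} (hy₀ : (y₀, v₀) ∈ G) :
    ∃ y z, y 0 = y₀ ∧ IsStrongSolutionOn G P Q (Ici 0) y z := by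
  choose yn zn hinit hyn using fun n : ℕ =>
    h.exists_isStrongSolutionOn_Icc hG hsv hy₀ (T := (n : ℝ) + 1) (by positivity)
  have hy_agree : ∀ m n : ℕ, ∀ t ∈ Icc 0 ((m : ℝ) + 1), t ∈ Icc 0 ((n : ℝ) + 1) →
      yn m t = yn n t := fun m n t hm hn =>
    h.eqOn_Icc_of_isStrongSolutionOn hG.1 ((hyn m).mono (Icc_subset_Icc_right hm.2))
      ((hyn n).mono (Icc_subset_Icc_right hn.2)) ((hinit m).trans (hinit n).symm)
      (right_mem_Icc.2 hm.1)
  have hz_agree : ∀ m n : ℕ, ∀ t ∈ Icc 0 ((m : ℝ) + 1), t ∈ Icc 0 ((n : ℝ) + 1) →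
      zn m t = zn n t := fun m n t hm hn =>
    hsv ((hyn m).mem t hm) (hy_agree m n t hm hn ▸ (hyn n).mem t hn)
  have hmem : ∀ {t : ℝ}, 0 ≤ t → t ∈ Icc 0 ((⌊t⌋₊ : ℝ) + 1) := fun ht =>
    ⟨ht, (Nat.lt_floor_add_one _).le⟩
  exact ⟨fun t => yn ⌊t⌋₊ t, fun t => zn ⌊t⌋₊ t, hinit _, .of_forall_Icc fun n => (hyn n).congr
    (fun t ht => hy_agree _ n t (hmem ht.1) ht) fun t ht => hz_agree _ n t (hmem ht.1) ht⟩

end LocalEvolutionCoefficients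

end StrongSolution

section Conjugation

variable {H : Type*} [NormedAddCommGroup H] [InnerProductSpace ℝ H]

/-- The graph of `𝒢 + ω`, where `𝒢` is the operator with graph `G`. -/
def shiftedGraph (ω : ℝ) (G : Set (H × H)) : Set (H × H) := {p | (p.1, p.2 - ω • p.1) ∈ G}

/-- The linear term `Q = D' D⁻¹ + ω D D̃` of the equation `y' = Q y - D D̃ z`, `z ∈ (𝒢 + ω) y`,
which `y = D x` solves when `x' = -D̃ 𝒢 D x`. -/
noncomputable def conjugateDrift (D Dt : ℝ → H →L[ℝ] H) (ω t : ℝ) : H →L[ℝ] H :=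
  derivWithin D (Ici 0) t * (D t).inverse + ω • (D t * Dt t)

variable {G : Set (H × H)} {A : ℝ → Set (H × H)} {D Dt : ℝ → H →L[ℝ] H} {ω : ℝ}

theorem IsSingleValued.shiftedGraph (hsv : IsSingleValued G) :
    IsSingleValued (shiftedGraph ω G) := fun _ _ _ hu hv => sub_left_injective (hsv hu hv)

theorem mem_shiftedGraph_add_smul {x w : H} : (x, w + ω • x) ∈ shiftedGraph ω G ↔ (x, w) ∈ G := by
  rw [shiftedGraph, mem_ofPred_eq, add_sub_cancel_right]

theorem velocity_conjugateDrift (t : ℝ) (y w : H) :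
    velocity (D * Dt) (conjugateDrift D Dt ω) t y (w + ω • y) =
      derivWithin D (Ici 0) t ((D t).inverse y) - D t (Dt t w) := by
  simp only [velocity, conjugateDrift, Pi.mul_apply, add_apply, smul_apply, mul_apply_eq_comp,
    map_add, map_smul]
  abel

theorem mem_iff_of_conjugate {B : Set (H × H)} {S R : H →L[ℝ] H} (hS : S.IsInvertible)
    (hB : {p : H × H | (S.inverse p.1, p.2) ∈ B} = {p | ∃ w, (p.1, w) ∈ G ∧ p.2 = R w})
    {x v : H} : (x, v) ∈ B ↔ ∃ w, (S x, w) ∈ G ∧ v = R w := by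
  have hmem := Set.ext_iff.1 hB (S x, v)
  simp only [mem_ofPred_eq, hS.inverse_apply_self] at hmem
  exact hmem

variable [CompleteSpace H]

theorem localEvolutionCoefficients_of_conjugate (hD : ContDiffOn ℝ 1 D (Ici 0))
    (hD_lip : LocallyLipschitzInTime (derivWithin D (Ici 0)))
    (hDt_lip : LocallyLipschitzInTime Dt) (hD_inv : ∀ t, 0 ≤ t → (D t).IsInvertible)
    (hDt_inv : ∀ t, 0 ≤ t → (Dt t).IsInvertible)
    (hsymm : ∀ t, 0 ≤ t → ∀ x y, inner ℝ (D t (Dt t x)) y = inner ℝ x (D t (Dt t y)))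
    (hcoercive : ∀ T : ℝ, 0 < T → ∃ c : ℝ, 0 < c ∧ ∀ t ∈ Icc 0 T, ∀ x,
      c * ‖x‖ ^ 2 ≤ inner ℝ ((Dt t).inverse ((D t).inverse x)) x) :
    LocalEvolutionCoefficients (D * Dt) (conjugateDrift D Dt ω)
      fun t => (Dt t).inverse * (D t).inverse := by
  have hP := locallyLipschitzOn_mul (locallyLipschitzOn_of_contDiffOn hD (convex_Ici 0))
    hDt_lip.locallyLipschitzOn
  have hDinv :=
    locallyLipschitzOn_inverse (locallyLipschitzOn_of_contDiffOn hD (convex_Ici 0)) hD_inv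
  exact
    { P_lip := hP
      Q_lip := (locallyLipschitzOn_mul hD_lip.locallyLipschitzOn hDinv).add
        (locallyLipschitzOn_const_smul ω hP)
      K_lip := locallyLipschitzOn_mul
        (locallyLipschitzOn_inverse hDt_lip.locallyLipschitzOn hDt_inv) hDinv
      symm := fun t ht x y => by
        have hinner := hsymm t ht ((Dt t).inverse ((D t).inverse x))
          ((Dt t).inverse ((D t).inverse y))
        simp only [(hD_inv t ht).self_apply_inverse, (hDt_inv t ht).self_apply_inverse] at hinner
        exact hinner.symm
      coercive := hcoercive
      left_inv := fun t ht x => by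
        simp only [Pi.mul_apply, mul_apply_eq_comp, (hD_inv t ht).inverse_apply_self,
          (hDt_inv t ht).inverse_apply_self] }

theorem IsSolution.exists_isStrongSolutionOn (hD : ContDiffOn ℝ 1 D (Ici 0))
    (hDt : ContinuousOn Dt (Ici 0)) (hD_inv : ∀ t, 0 ≤ t → (D t).IsInvertible)
    (hDt_inv : ∀ t, 0 ≤ t → (Dt t).IsInvertible)
    (hA : ∀ t, 0 ≤ t → ∀ x v, (x, v) ∈ A t ↔ ∃ w, (D t x, w) ∈ G ∧ v = Dt t w)
    {x₀ : H} {x : ℝ → H} (hx : IsSolution A x₀ x) :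
    ∃ z, IsStrongSolutionOn (shiftedGraph ω G) (D * Dt) (conjugateDrift D Dt ω) (Ici 0)
      (fun t => D t (x t)) z := by
  obtain ⟨hx_cont, -, v, hv, N, hN, hderiv⟩ := hx
  have hy : ContinuousOn (fun t => D t (x t)) (Ici 0) := hD.continuousOn.clm_apply hx_cont
  refine ⟨fun t => (Dt t).inverse (v t) + ω • D t (x t), hy, fun t ht => ?_, N, hN,
    fun t ht htN => ⟨?_, ?_⟩⟩
  · obtain ⟨w, hw, hvw⟩ := (hA t ht _ _).1 (hv t ht)
    rwa [mem_shiftedGraph_add_smul, hvw, (hDt_inv t ht).inverse_apply_self]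
  · refine ((hD.differentiableOn one_ne_zero t ht).hasDerivWithinAt.clm_apply
      (hderiv t ht htN).1).congr_deriv ?_
    rw [velocity_conjugateDrift, (hD_inv t ht).inverse_apply_self,
      (hDt_inv t ht).self_apply_inverse, map_neg, sub_eq_add_neg]
  · exact ((continuousWithinAt_inverse (hDt t ht) (hDt_inv t ht)).clm_apply
      (hderiv t ht htN).2).add ((hy t ht).const_smul ω)

theorem IsStrongSolutionOn.isSolution (hD : ContDiffOn ℝ 1 D (Ici 0))
    (hDt : ContinuousOn Dt (Ici 0)) (hD_inv : ∀ t, 0 ≤ t → (D t).IsInvertible)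
    (hA : ∀ t, 0 ≤ t → ∀ x v, (x, v) ∈ A t ↔ ∃ w, (D t x, w) ∈ G ∧ v = Dt t w)
    {y z : ℝ → H} (hy : IsStrongSolutionOn (shiftedGraph ω G) (D * Dt) (conjugateDrift D Dt ω)
      (Ici 0) y z) :
    IsSolution A ((D 0).inverse (y 0)) fun t => (D t).inverse (y t) := by
  have hDinv_deriv : ∀ t, 0 ≤ t → HasDerivWithinAt (fun t => (D t).inverse)
      (-((D t).inverse * derivWithin D (Ici 0) t * (D t).inverse)) (Ici 0) t := fun t ht =>
    hasDerivWithinAt_inverse (hD.differentiableOn one_ne_zero t ht).hasDerivWithinAt (hD_inv t ht)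
  obtain ⟨N, hN, hderiv⟩ := hy.exists_countable
  refine ⟨fun t ht => (hDinv_deriv t ht).continuousWithinAt.clm_apply (hy.continuousOn t ht), rfl,
    fun t => Dt t (z t - ω • y t), fun t ht => ?_, N, hN, fun t ht htN => ⟨?_, ?_⟩⟩
  · refine (hA t ht _ _).2 ⟨z t - ω • y t, ?_, rfl⟩
    rw [(hD_inv t ht).self_apply_inverse]
    exact hy.mem t ht
  · have hvel := velocity_conjugateDrift (D := D) (Dt := Dt) (ω := ω) t (y t) (z t - ω • y t)
    rw [sub_add_cancel] at hvel
    refine ((hDinv_deriv t ht).clm_apply (hderiv t ht htN).1).congr_deriv ?_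
    simp only [hvel, neg_apply, mul_apply_eq_comp, map_sub, (hD_inv t ht).inverse_apply_self]
    abel
  · exact (hDt t ht).clm_apply ((hderiv t ht htN).2.sub ((hy.continuousOn t ht).const_smul ω))

end Conjugation

section Damping

variable {V : Type*} [NormedAddCommGroup V] [NormedSpace ℝ V]
  {J : ℕ} {X : Fin J → Type*} [∀ j, MeasurableSpace (X j)] {μ : ∀ j, Measure (X j)}
  {N : Fin J → ℕ} {U : ∀ j, Submodule ℝ (Lp (EuclideanSpace ℝ (Fin (N j))) 2 (μ j))}

theorem dampingPairing_of_forall_eq (IU : V →L[ℝ] (∀ j, U j))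
    (g : ∀ j, EuclideanSpace ℝ (Fin (N j)) → EuclideanSpace ℝ (Fin (N j)))
    {a : ∀ j, X j → ℝ} {b : ℝ} (ha : ∀ j x, a j x = b) (u v : V) :
    dampingPairing IU g a u v = b * dampingPairing IU g (fun _ _ => 1) u v := by
  simp only [dampingPairing, ha, one_mul, Finset.mul_sum, integral_const_mul]

end Damping

end HyperbolicFeedback

theorem mainTheorem5_general {H : Type*} [NormedAddCommGroup H] [InnerProductSpace ℝ H]
    [CompleteSpace H] {G : Set (H × H)} (hmax : IsMaximalQuasiMonotone G) (hsv : IsSingleValued G)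
    {D Dt : ℝ → H →L[ℝ] H} (hD : ContDiffOn ℝ 1 D (Ici 0))
    (hD_lip : LocallyLipschitzInTime (derivWithin D (Ici 0)))
    (hDt_lip : LocallyLipschitzInTime Dt) (hD_inv : ∀ t, 0 ≤ t → (D t).IsInvertible)
    (hDt_inv : ∀ t, 0 ≤ t → (Dt t).IsInvertible)
    (hsymm : ∀ t, 0 ≤ t → ∀ x y, inner ℝ (D t (Dt t x)) y = inner ℝ x (D t (Dt t y)))
    (hcoercive : ∀ T : ℝ, 0 < T → ∃ c : ℝ, 0 < c ∧ ∀ t ∈ Icc 0 T, ∀ x,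
      c * ‖x‖ ^ 2 ≤ inner ℝ ((Dt t).inverse ((D t).inverse x)) x)
    {A : ℝ → Set (H × H)}
    (hcomm : ∀ t, 0 ≤ t → {p : H × H | ((D t).inverse p.1, p.2) ∈ A t} =
      {p : H × H | ∃ w : H, (p.1, w) ∈ G ∧ p.2 = Dt t w})
    {x₀ : H} (hx₀ : x₀ ∈ operatorDomain (A 0)) :
    ∃ x : ℝ → H, IsSolution A x₀ x ∧ ∀ y : ℝ → H, IsSolution A x₀ y → EqOn y x (Ici 0) := by
  obtain ⟨ω, -, hGω⟩ := hmax
  have hDt := hDt_lip.locallyLipschitzOn.continuousOn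
  have hA := fun t ht x v => mem_iff_of_conjugate (hD_inv t ht) (hcomm t ht) (x := x) (v := v)
  have hcoef := localEvolutionCoefficients_of_conjugate (ω := ω) hD hD_lip hDt_lip hD_inv hDt_inv
    hsymm hcoercive
  obtain ⟨v₀, hv₀⟩ := hx₀
  obtain ⟨w₀, hw₀, -⟩ := (hA 0 le_rfl x₀ v₀).1 hv₀
  obtain ⟨y, z, hinit, hyz⟩ := hcoef.exists_isStrongSolutionOn_Ici hGω hsv.shiftedGraph
    (mem_shiftedGraph_add_smul.2 hw₀)
  have hsol := hyz.isSolution hD hDt hD_inv hA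
  rw [hinit, (hD_inv 0 le_rfl).inverse_apply_self] at hsol
  refine ⟨_, hsol, fun x hx t ht => ?_⟩
  obtain ⟨z', hyz'⟩ := hx.exists_isStrongSolutionOn (ω := ω) hD hDt hD_inv hDt_inv hA
  have heq := hcoef.eqOn_Ici_of_isStrongSolutionOn hGω.1 hyz' hyz (by rw [hx.2.1, hinit]) ht
  rw [← heq, (hD_inv t ht).inverse_apply_self]

theorem mainTheorem5
    -- the Hilbert spaces, with `V` densely and continuously embedded into `H`
    {V H : Type*}
    [NormedAddCommGroup H] [InnerProductSpace ℝ H] [CompleteSpace H]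
    [NormedAddCommGroup V] [InnerProductSpace ℝ V] [CompleteSpace V]
    (ι : V →L[ℝ] H) (hι : Function.Injective ι) (hιd : DenseRange ι)
    -- the control space `U = ∏ U_j`, with `U_j` closed in `L²(X_j, μ_j)^{N_j}`
    {J : ℕ} {X : Fin J → Type*} [∀ j, MeasurableSpace (X j)]
    (μ : ∀ j, Measure (X j)) [∀ j, IsFiniteMeasure (μ j)] (N : Fin J → ℕ)
    (U : ∀ j, Submodule ℝ (Lp (EuclideanSpace ℝ (Fin (N j))) 2 (μ j)))
    (hU : ∀ j, IsClosed (U j : Set (Lp (EuclideanSpace ℝ (Fin (N j))) 2 (μ j))))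
    (IU : V →L[ℝ] (∀ j, U j))
    -- the nonlinearities
    (g : ∀ j, EuclideanSpace ℝ (Fin (N j)) → EuclideanSpace ℝ (Fin (N j)))
    (hgc : ∀ j, Continuous (g j))
    (hgm : ∀ j x y, 0 ≤ inner ℝ (g j x - g j y) (x - y))
    (hg0 : ∀ j, g j 0 = 0)
    (hgb : ∃ M : ℝ, 0 < M ∧ ∀ j x, ‖g j x‖ ≤ M * (1 + ‖x‖))
    -- the coefficients, which depend on time only and coincide
    (αj : ∀ j, ℝ → X j → ℝ) (α : ℝ → ℝ)
    (hαj : ∀ j t, 0 ≤ t → ∀ x, αj j t x = α t)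
    (hα : ContDiffOn ℝ 1 α (Set.Ici 0)) (hαpos : ∀ t, 0 ≤ t → 0 < α t)
    (hαlip : LocallyLipschitzInTime (derivWithin α (Set.Ici 0)))
    -- the operator `A_1 : V → V'`
    (A₁ : V →L[ℝ] StrongDual ℝ V)
    -- `A_1 + B_1` is maximal quasi-monotone with dense domain in `H`
    (hmax : IsMaximalQuasiMonotone
      (partInH ι (fun u v => A₁ u v + dampingPairing IU g (fun _ _ => 1) u v)))
    (hdense : Dense (operatorDomain
      (partInH ι (fun u v => A₁ u v + dampingPairing IU g (fun _ _ => 1) u v))))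
    -- the operator families `D` and `D̃`
    (D Dt : ℝ → H →L[ℝ] H)
    (hD : ContDiffOn ℝ 1 D (Set.Ici 0))
    (hDlip : LocallyLipschitzInTime (derivWithin D (Set.Ici 0)))
    (hDtc : ContinuousOn Dt (Set.Ici 0)) (hDtlip : LocallyLipschitzInTime Dt)
    (hDinv : ∀ t, 0 ≤ t → (D t).IsInvertible) (hDtinv : ∀ t, 0 ≤ t → (Dt t).IsInvertible)
    (hsym : ∀ t, 0 ≤ t → ∀ x y, inner ℝ (D t (Dt t x)) y = inner ℝ x (D t (Dt t y)))
    (hpos : ∀ t, 0 ≤ t → ∀ x, x ≠ 0 → 0 < inner ℝ (D t (Dt t x)) x)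
    (hcoer : ∀ T : ℝ, 0 < T → ∃ c : ℝ, 0 < c ∧ ∀ t ∈ Set.Icc 0 T, ∀ x,
      c * ‖x‖ ^ 2 ≤ inner ℝ ((Dt t).inverse ((D t).inverse x)) x)
    -- `(A_1 + α(t) B_1) D(t)⁻¹ = D̃(t) (A_1 + B_1)` as operators in `H`
    (hcomm : ∀ t, 0 ≤ t →
      {p : H × H | ((D t).inverse p.1, p.2) ∈
        partInH ι (fun u v => A₁ u v + α t * dampingPairing IU g (fun _ _ => 1) u v)} =
      {p : H × H | ∃ w : H, (p.1, w) ∈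
        partInH ι (fun u v => A₁ u v + dampingPairing IU g (fun _ _ => 1) u v) ∧ p.2 = Dt t w})
    -- the initial datum lies in the domain of `A_1 + B(0)`
    (x₀ : H)
    (hx₀ : x₀ ∈ operatorDomain
      (partInH ι (fun u v => A₁ u v + dampingPairing IU g (fun j => αj j 0) u v))) :
    ∃ x : ℝ → H,
      IsSolution
        (fun t => partInH ι (fun u v => A₁ u v + dampingPairing IU g (fun j => αj j t) u v)) x₀ x ∧
      ∀ y : ℝ → H,
        IsSolution
          (fun t => partInH ι (fun u v => A₁ u v + dampingPairing IU g (fun j => αj j t) u v))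
          x₀ y →
        Set.EqOn y x (Set.Ici 0) := by
  refine mainTheorem5_general hmax (fun _ _ _ => partInH_singleValued hι hιd) hD hDlip hDtlip
    hDinv hDtinv hsym hcoer (fun t ht => ?_) hx₀
  simpa only [dampingPairing_of_forall_eq IU g fun j => hαj j t ht] using hcomm t ht
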